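/- Let $n$ and $k$ be integers with $0<k<n$, and regard all spaces below as representations of $SL_n(\mathbb{C})$, where $\mathbb{C}^n$ is the standard representation and $\mathfrak{sl}_n$ is the space of traceless $n\times n$ matrices with the adjoint (conjugation) action. Put $M=\Lambda^k\mathbb{C}^n$ and $M^*=\Lambda^{n-k}\mathbb{C}^n$, which is isomorphic to the dual representation of $M$. Then $\mathfrak{sl}_n$ is isomorphic to the Schur module $S_{2,1^{n-2}}\mathbb{C}^n$ (the image of the Young symmetrizer of the partition $(2,1^{n-2})$ on $(\mathbb{C}^n)^{\otimes n}$), and $M\otimes M^*$ contains exactly one copy of it: there is exactly one subrepresentation of $M\otimes M^*$ isomorphic to $\mathfrak{sl}_n$. Moreover, if $n=2k$, so that $M^*=M$, then the unique copy of $\mathfrak{sl}_n$ in $M\otimes M$ is contained in the space $S^2M$ of symmetric tensors when $k$ is odd, and in the space $\Lambda^2M$ of skew-symmetric tensors when $k$ is even. -/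

import Mathlib

open scoped TensorProduct MatrixGroups

noncomputable section

namespace DualBrackets

section Functorial

variable {G V : Type*} [Group G] [AddCommGroup V] [Module ℂ V]

/-- The `k`-th exterior power of a representation:
`g • (v₁ ∧ ⋯ ∧ vₖ) = g v₁ ∧ ⋯ ∧ g vₖ`. -/
def extPow (ρ : Representation ℂ G V) (k : ℕ) : Representation ℂ G (⋀[ℂ]^k V) where
  toFun g := exteriorPower.map k (ρ g)
  map_one' := by
    rw [map_one]
    exact exteriorPower.map_id
  map_mul' g h := by
    rw [map_mul]
    exact exteriorPower.map_comp (ρ h) (ρ g)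

/-- The tensor power of a representation, with tensor factors indexed by a type `ι`:
`g • ⨂ᵢ vᵢ = ⨂ᵢ g vᵢ`. -/
def tensorPow (ρ : Representation ℂ G V) (ι : Type*) :
    Representation ℂ G (⨂[ℂ] _ : ι, V) where
  toFun g := PiTensorProduct.map (fun _ => ρ g)
  map_one' := by
    rw [map_one]
    exact PiTensorProduct.map_one
  map_mul' g h := by
    rw [map_mul]
    exact PiTensorProduct.map_mul (fun _ => ρ g) (fun _ => ρ h)

/-- The symmetric tensors in `V ⊗ V`, i.e. the summand `S² V`: the tensors `x` that are equal
to their image under the swap `v ⊗ w ↦ w ⊗ v`. -/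
def symTensors (V : Type*) [AddCommGroup V] [Module ℂ V] : Submodule ℂ (V ⊗[ℂ] V) :=
  LinearMap.eqLocus (TensorProduct.comm ℂ V V).toLinearMap LinearMap.id

/-- The skew-symmetric tensors in `V ⊗ V`, i.e. the summand `Λ² V`: the tensors `x` that are
mapped to `-x` by the swap `v ⊗ w ↦ w ⊗ v`. -/
def skewTensors (V : Type*) [AddCommGroup V] [Module ℂ V] : Submodule ℂ (V ⊗[ℂ] V) :=
  LinearMap.eqLocus (TensorProduct.comm ℂ V V).toLinearMap (-LinearMap.id)

end Functorial

section Schur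

/-- The action on `V^{⊗μ}` (one tensor factor for each cell of `μ`) of a permutation of the
cells. -/
def permTensor (V : Type*) [AddCommGroup V] [Module ℂ V] (μ : YoungDiagram)
    (σ : Equiv.Perm μ.cells) : (⨂[ℂ] _ : μ.cells, V) →ₗ[ℂ] (⨂[ℂ] _ : μ.cells, V) :=
  (PiTensorProduct.reindex ℂ (fun _ : μ.cells => V) σ).toLinearMap

open Classical in
/-- The row symmetrizer: the sum of all permutations of the cells that preserve every row. -/
def rowSymmetrizer (V : Type*) [AddCommGroup V] [Module ℂ V] (μ : YoungDiagram) :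
    (⨂[ℂ] _ : μ.cells, V) →ₗ[ℂ] (⨂[ℂ] _ : μ.cells, V) :=
  ∑ σ : Equiv.Perm μ.cells with (∀ c : μ.cells, (σ c).1.1 = c.1.1), permTensor V μ σ

open Classical in
/-- The column antisymmetrizer: the signed sum of all permutations of the cells that preserve
every column. -/
def colAntisymmetrizer (V : Type*) [AddCommGroup V] [Module ℂ V] (μ : YoungDiagram) :
    (⨂[ℂ] _ : μ.cells, V) →ₗ[ℂ] (⨂[ℂ] _ : μ.cells, V) :=
  ∑ σ : Equiv.Perm μ.cells with (∀ c : μ.cells, (σ c).1.2 = c.1.2),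
    ((Equiv.Perm.sign σ : ℤ) : ℂ) • permTensor V μ σ

/-- The Young symmetrizer of `μ` acting on `V^{⊗μ}` (first symmetrize along the rows, then
antisymmetrize along the columns). -/
def youngSymmetrizer (V : Type*) [AddCommGroup V] [Module ℂ V] (μ : YoungDiagram) :
    (⨂[ℂ] _ : μ.cells, V) →ₗ[ℂ] (⨂[ℂ] _ : μ.cells, V) :=
  colAntisymmetrizer V μ ∘ₗ rowSymmetrizer V μ

variable {G V : Type*} [Group G] [AddCommGroup V] [Module ℂ V]

theorem map_permTensor (f : V →ₗ[ℂ] V) (μ : YoungDiagram) (σ : Equiv.Perm μ.cells)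
    (x : ⨂[ℂ] _ : μ.cells, V) :
    PiTensorProduct.map (fun _ => f) (permTensor V μ σ x)
      = permTensor V μ σ (PiTensorProduct.map (fun _ => f) x) :=
  PiTensorProduct.map_reindex (fun _ : μ.cells => f) σ x

theorem map_youngSymmetrizer (f : V →ₗ[ℂ] V) (μ : YoungDiagram)
    (x : ⨂[ℂ] _ : μ.cells, V) :
    PiTensorProduct.map (fun _ => f) (youngSymmetrizer V μ x)
      = youngSymmetrizer V μ (PiTensorProduct.map (fun _ => f) x) := by
  simp only [youngSymmetrizer, colAntisymmetrizer, rowSymmetrizer, LinearMap.comp_apply,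
    LinearMap.sum_apply, LinearMap.smul_apply, map_sum, map_smul, map_permTensor]

/-- The Schur module `S_μ V`: the image of the Young symmetrizer on `V^{⊗μ}`, as a
subrepresentation of the tensor power. -/
def schurSubrep (ρ : Representation ℂ G V) (μ : YoungDiagram) :
    Subrepresentation (tensorPow ρ μ.cells) where
  toSubmodule := LinearMap.range (youngSymmetrizer V μ)
  apply_mem_toSubmodule g v hv := by
    obtain ⟨x, rfl⟩ := hv
    exact ⟨PiTensorProduct.map (fun _ => ρ g) x, (map_youngSymmetrizer (ρ g) μ x).symm⟩

/-- The Schur module `S_μ V` as a representation. -/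
def schurModule (ρ : Representation ℂ G V) (μ : YoungDiagram) :
    Representation ℂ G (schurSubrep ρ μ).toSubmodule :=
  (schurSubrep ρ μ).toRepresentation

/-- The partition `(2, 1^m)`: one row of length two followed by `m` rows of length one. -/
def hookTwoOnes (m : ℕ) : YoungDiagram :=
  YoungDiagram.ofRowLens (2 :: List.replicate m 1) (by
    rw [List.sortedGE_iff_pairwise, List.pairwise_cons]
    refine ⟨fun b hb => ?_, List.pairwise_replicate.2 (Or.inr le_rfl)⟩
    rw [List.eq_of_mem_replicate hb]
    exact one_le_two)

end Schur

section SpecialLinear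

variable (n : ℕ)

/-- The standard representation of `SL_n(ℂ)` on `ℂⁿ`. -/
def stdRep : Representation ℂ SL(n, ℂ) (Fin n → ℂ) where
  toFun g := Matrix.toLin' (g : Matrix (Fin n) (Fin n) ℂ)
  map_one' := by
    rw [Matrix.SpecialLinearGroup.coe_one, Matrix.toLin'_one]
    rfl
  map_mul' g h := by
    rw [Matrix.SpecialLinearGroup.coe_mul, Matrix.toLin'_mul]
    rfl

/-- The adjoint representation of `SL_n(ℂ)` on the space `𝔰𝔩ₙ` of traceless matrices:
`g • A = g A g⁻¹`. -/
def adjointRep : Representation ℂ SL(n, ℂ) (LieAlgebra.SpecialLinear.sl (Fin n) ℂ) where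
  toFun g :=
    { toFun := fun A => ⟨(g : Matrix (Fin n) (Fin n) ℂ) * A.1 *
          ((g⁻¹ : SL(n, ℂ)) : Matrix (Fin n) (Fin n) ℂ), by
        have hA : Matrix.trace A.1 = 0 := A.2
        change Matrix.trace ((g : Matrix (Fin n) (Fin n) ℂ) * A.1 *
          ((g⁻¹ : SL(n, ℂ)) : Matrix (Fin n) (Fin n) ℂ)) = 0
        rw [Matrix.trace_mul_cycle, ← Matrix.SpecialLinearGroup.coe_mul, inv_mul_cancel,
          Matrix.SpecialLinearGroup.coe_one, Matrix.one_mul, hA]⟩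
      map_add' := fun A B => Subtype.ext (by
        simp [Matrix.mul_add, Matrix.add_mul])
      map_smul' := fun c A => Subtype.ext (by simp) }
  map_one' := by
    refine LinearMap.ext fun A => Subtype.ext ?_
    simp
  map_mul' g h := by
    refine LinearMap.ext fun A => Subtype.ext ?_
    simp only [mul_inv_rev, Matrix.SpecialLinearGroup.coe_mul, LinearMap.coe_mk, AddHom.coe_mk,
      Module.End.mul_apply, Matrix.mul_assoc]

/-- The fundamental representation `Λᵏ ℂⁿ` of `SL_n(ℂ)`. -/
def wedge (k : ℕ) : Representation ℂ SL(n, ℂ) (⋀[ℂ]^k (Fin n → ℂ)) :=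
  extPow (stdRep n) k

end SpecialLinear

/-- The subrepresentation `W` of `ρ` is a copy of the representation `σ`, i.e. it is
isomorphic to `σ`. -/
def IsCopyOf {G U V : Type*} [Group G] [AddCommMonoid U] [Module ℂ U] [AddCommMonoid V]
    [Module ℂ V] {ρ : Representation ℂ G V} (W : Subrepresentation ρ)
    (σ : Representation ℂ G U) : Prop :=
  Nonempty (W.toRepresentation.Equiv σ)

end DualBrackets

end

/-! Tensors in `Λᵏ ⊗ Λˡ` with `k + l = n` are tested by products of minors, indexed by pairs of
lists `(p, q)`. Let `f` be an equivariant map from `𝔰𝔩ₙ` and `E` the elementary matrix at `(z, w)`,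
`z ≠ w`. Diagonal elements of `SL_n` force a coordinate of `f E` to vanish unless `(p, q)` has the
weight of `E`: together the lists contain `z` twice, omit `w` and contain every other index once
(`isBalanced_of_minorProd_ne_zero`). For nonzero minors each list contains `z` exactly once. Up to
reordering inside the lists, all such pairs are conjugate under permutations fixing `z` and `w`, and
such a permutation changes the coordinate by its sign (`minorProd_comp_of_isBalanced`). So one
coordinate determines `f E`. Since `E` generates `𝔰𝔩ₙ` (`eq_top_of_single_mem`), it determines `f`,
and the space of equivariant maps has dimension at most one (`eq_smul_of_equivariant`).

A nonzero map exists: the wedge pairing into `Λⁿ = ℂ` identifies `Λˡ` with the dual of `Λᵏ`, hence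
`Λᵏ ⊗ Λˡ` with `End Λᵏ`, which receives `𝔰𝔩ₙ` through its action by derivations
(`adjointEmbedding`). Every copy of `𝔰𝔩ₙ` is the range of an equivariant injection, so it is the
range of this one.

For `n = 2k`, composing with the swap of the factors exchanges `p` and `q`. The `k - 1`
transpositions matching their entries other than `z` do the same, so the swap acts by `(-1)^(k-1)`
(`comm_comp_equivariant`).

For the Schur module, `hookMap` sends `⨂ vₜ` to `u ↦ det(v with u in place of vₐ) vₐ`, with `a` the
cell in the second column. Column antisymmetrization only rescales its value, and a tensor that it
kills is killed by the column antisymmetrizer; this gives injectivity on the Schur module. The trace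
of its value is the full determinant, which vanishes after row symmetrization, so the image lies in
`𝔰𝔩ₙ`. It is invariant and contains an elementary matrix, so it is everything. -/

namespace DualBrackets

open Matrix Module

/-! ### Minors as coordinates on exterior powers and their tensor products. -/

section Wedge

variable {n k l : ℕ}

/-- The linear form on `Λᵏ ℂⁿ` sending `v₁ ∧ ⋯ ∧ vₖ` to the determinant of the matrix of the
coordinates of the `vᵢ` listed by `p`. -/
noncomputable def minorForm (p : Fin k → Fin n) : Dual ℂ (⋀[ℂ]^k (Fin n → ℂ)) :=
  exteriorPower.alternatingMapLinearEquiv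
    (Matrix.detRowAlternating.compLinearMap (LinearMap.funLeft ℂ ℂ p))

lemma minorForm_ιMulti (p : Fin k → Fin n) (v : Fin k → Fin n → ℂ) :
    minorForm p (exteriorPower.ιMulti ℂ k v) = (Matrix.of fun i j => v i (p j)).det := by
  rw [minorForm, exteriorPower.alternatingMapLinearEquiv_apply_ιMulti]
  rfl

lemma minorForm_comp_perm (p : Fin k → Fin n) (α : Equiv.Perm (Fin k)) :
    minorForm (p ∘ α) = ((Equiv.Perm.sign α : ℤ) : ℂ) • minorForm p := by
  refine exteriorPower.linearMap_ext (AlternatingMap.ext fun v => ?_)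
  simp only [LinearMap.compAlternatingMap_apply, LinearMap.smul_apply, minorForm_ιMulti]
  exact Matrix.det_permute' α (Matrix.of fun i j => v i (p j))

lemma minorForm_eq_zero {p : Fin k → Fin n} (hp : ¬ Function.Injective p) : minorForm p = 0 := by
  refine exteriorPower.linearMap_ext (AlternatingMap.ext fun v => ?_)
  simp only [LinearMap.compAlternatingMap_apply, LinearMap.zero_apply, minorForm_ιMulti]
  simp only [Function.Injective, not_forall] at hp
  obtain ⟨i, j, hij, hne⟩ := hp
  refine Matrix.det_zero_of_column_eq hne fun m => ?_
  simp [hij]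

/-- Basis coordinates are the minors of increasing lists. Working with arbitrary lists instead lets
permutations of the indices act by composition, with no sorting. -/
lemma exteriorPower_coord_eq_minorForm (s : Set.powersetCard (Fin n) k) :
    ((Pi.basisFun ℂ (Fin n)).exteriorPower k).coord s
      = minorForm (Set.powersetCard.ofFinEmbEquiv.symm s) := by
  rw [exteriorPower.basis_coord]
  refine exteriorPower.linearMap_ext (AlternatingMap.ext fun v => ?_)
  simp only [LinearMap.compAlternatingMap_apply, minorForm_ιMulti,
    exteriorPower.ιMultiDual_apply_ιMulti]
  rfl

lemma eq_zero_of_minorForm_eq_zero {x : ⋀[ℂ]^k (Fin n → ℂ)}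
    (hx : ∀ p : Fin k → Fin n, Function.Injective p → minorForm p x = 0) : x = 0 := by
  refine ((Pi.basisFun ℂ (Fin n)).exteriorPower k).ext_elem fun s => ?_
  rw [← Basis.coord_apply, exteriorPower_coord_eq_minorForm, map_zero, Finsupp.zero_apply]
  exact hx _ (Set.powersetCard.ofFinEmbEquiv.symm s).injective

/-- The product of two minor forms, as a linear form on `Λᵏ ℂⁿ ⊗ Λˡ ℂⁿ`. -/
noncomputable def minorProd (p : Fin k → Fin n) (q : Fin l → Fin n) :
    Dual ℂ ((⋀[ℂ]^k (Fin n → ℂ)) ⊗[ℂ] (⋀[ℂ]^l (Fin n → ℂ))) :=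
  TensorProduct.dualDistrib ℂ _ _ (minorForm p ⊗ₜ minorForm q)

@[simp] lemma minorProd_tmul (p : Fin k → Fin n) (q : Fin l → Fin n)
    (x : ⋀[ℂ]^k (Fin n → ℂ)) (y : ⋀[ℂ]^l (Fin n → ℂ)) :
    minorProd p q (x ⊗ₜ y) = minorForm p x * minorForm q y := by
  simp [minorProd]

lemma minorProd_comp_perm (p : Fin k → Fin n) (q : Fin l → Fin n) (α : Equiv.Perm (Fin k))
    (β : Equiv.Perm (Fin l)) :
    minorProd (p ∘ α) (q ∘ β)
      = (((Equiv.Perm.sign α : ℤ) : ℂ) * ((Equiv.Perm.sign β : ℤ) : ℂ)) • minorProd p q := by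
  refine TensorProduct.ext' fun x y => ?_
  simp only [minorProd_tmul, minorForm_comp_perm, LinearMap.smul_apply, smul_eq_mul]
  ring

lemma injective_of_minorProd_ne_zero {p : Fin k → Fin n} {q : Fin l → Fin n}
    {x : (⋀[ℂ]^k (Fin n → ℂ)) ⊗[ℂ] (⋀[ℂ]^l (Fin n → ℂ))} (h : minorProd p q x ≠ 0) :
    Function.Injective p ∧ Function.Injective q := by
  constructor
  all_goals
    by_contra hp
    simp [minorProd, minorForm_eq_zero hp] at h

lemma eq_zero_of_minorProd_eq_zero
    {x : (⋀[ℂ]^k (Fin n → ℂ)) ⊗[ℂ] (⋀[ℂ]^l (Fin n → ℂ))}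
    (hx : ∀ (p : Fin k → Fin n) (q : Fin l → Fin n), minorProd p q x = 0) : x = 0 := by
  refine (((Pi.basisFun ℂ (Fin n)).exteriorPower k).tensorProduct
    ((Pi.basisFun ℂ (Fin n)).exteriorPower l)).ext_elem fun s => ?_
  have key : (((Pi.basisFun ℂ (Fin n)).exteriorPower k).tensorProduct
      ((Pi.basisFun ℂ (Fin n)).exteriorPower l)).coord s
        = minorProd (Set.powersetCard.ofFinEmbEquiv.symm s.1)
          (Set.powersetCard.ofFinEmbEquiv.symm s.2) := by
    refine TensorProduct.ext' fun x y => ?_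
    rw [minorProd_tmul, ← exteriorPower_coord_eq_minorForm, ← exteriorPower_coord_eq_minorForm]
    rw [Basis.coord_apply, Basis.tensorProduct_repr_tmul_apply, smul_eq_mul,
      Basis.coord_apply, Basis.coord_apply]
    exact mul_comm _ _
  rw [← Basis.coord_apply, key, map_zero, Finsupp.zero_apply]
  exact hx _ _

lemma minorProd_comm (p q : Fin k → Fin n)
    (x : (⋀[ℂ]^k (Fin n → ℂ)) ⊗[ℂ] (⋀[ℂ]^k (Fin n → ℂ))) :
    minorProd p q (TensorProduct.comm ℂ _ _ x) = minorProd q p x := by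
  induction x with
  | zero => simp
  | add x y hx hy => simp only [map_add, hx, hy]
  | tmul x y => simp [mul_comm]

/-! ### Monomial matrices in `SL_n` and their action on minors and on `𝔰𝔩ₙ`. -/

/-- The element of `SL_n(ℂ)` acting on coordinates by `(g v)ᵢ = εᵢ v_{σ i}`. -/
noncomputable def monomialSL (σ : Equiv.Perm (Fin n)) (ε : Fin n → ℂ)
    (h : ((Equiv.Perm.sign σ : ℤ) : ℂ) * ∏ i, ε i = 1) : SL(n, ℂ) :=
  ⟨Matrix.diagonal ε * σ.permMatrix ℂ, by
    rw [Matrix.det_mul, Matrix.det_diagonal, Matrix.det_permutation, mul_comm, h]⟩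

lemma monomialSL_apply (σ : Equiv.Perm (Fin n)) (ε : Fin n → ℂ)
    (h : ((Equiv.Perm.sign σ : ℤ) : ℂ) * ∏ i, ε i = 1) (i j : Fin n) :
    (monomialSL σ ε h : Matrix (Fin n) (Fin n) ℂ) i j = if σ i = j then ε i else 0 := by
  simp [monomialSL, Matrix.diagonal_mul, Equiv.Perm.permMatrix, PEquiv.toMatrix_apply, eq_comm]

lemma stdRep_monomialSL (σ : Equiv.Perm (Fin n)) (ε : Fin n → ℂ)
    (h : ((Equiv.Perm.sign σ : ℤ) : ℂ) * ∏ i, ε i = 1) (v : Fin n → ℂ) (i : Fin n) :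
    stdRep n (monomialSL σ ε h) v i = ε i * v (σ i) := by
  simp [stdRep, Matrix.toLin'_apply, Matrix.mulVec, dotProduct, monomialSL_apply, ite_mul]

lemma wedge_ιMulti (g : SL(n, ℂ)) (v : Fin k → Fin n → ℂ) :
    wedge n k g (exteriorPower.ιMulti ℂ k v)
      = exteriorPower.ιMulti ℂ k (fun i => stdRep n g (v i)) :=
  exteriorPower.map_apply_ιMulti _ _

lemma minorForm_monomialSL (σ : Equiv.Perm (Fin n)) (ε : Fin n → ℂ)
    (h : ((Equiv.Perm.sign σ : ℤ) : ℂ) * ∏ i, ε i = 1) (p : Fin k → Fin n)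
    (x : ⋀[ℂ]^k (Fin n → ℂ)) :
    minorForm p (wedge n k (monomialSL σ ε h) x) = (∏ j, ε (p j)) * minorForm (σ ∘ p) x := by
  suffices H : minorForm p ∘ₗ wedge n k (monomialSL σ ε h)
      = (∏ j, ε (p j)) • minorForm (σ ∘ p) from LinearMap.congr_fun H x
  refine exteriorPower.linearMap_ext (AlternatingMap.ext fun v => ?_)
  simp only [LinearMap.compAlternatingMap_apply, LinearMap.comp_apply, wedge_ιMulti,
    LinearMap.smul_apply, minorForm_ιMulti, stdRep_monomialSL, smul_eq_mul]
  exact Matrix.det_mul_row _ _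

lemma minorProd_monomialSL (σ : Equiv.Perm (Fin n)) (ε : Fin n → ℂ)
    (h : ((Equiv.Perm.sign σ : ℤ) : ℂ) * ∏ i, ε i = 1) (p : Fin k → Fin n) (q : Fin l → Fin n)
    (x : (⋀[ℂ]^k (Fin n → ℂ)) ⊗[ℂ] (⋀[ℂ]^l (Fin n → ℂ))) :
    minorProd p q ((wedge n k).tprod (wedge n l) (monomialSL σ ε h) x)
      = (∏ j, ε (p j)) * (∏ j, ε (q j)) * minorProd (σ ∘ p) (σ ∘ q) x := by
  induction x with
  | zero => simp
  | add x y hx hy => simp only [map_add, hx, hy, mul_add]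
  | tmul x y =>
    simp only [Representation.tprod_apply, TensorProduct.map_tmul, minorProd_tmul,
      minorForm_monomialSL]
    ring

/-- Multiplying by `g` on the right clears the inverse, so that conjugates can be compared entry by
entry. -/
lemma adjointRep_mul (g : SL(n, ℂ)) (A : LieAlgebra.SpecialLinear.sl (Fin n) ℂ) :
    (adjointRep n g A).1 * (g : Matrix (Fin n) (Fin n) ℂ) = g * A.1 := by
  change (g : Matrix (Fin n) (Fin n) ℂ) * A.1 * ((g⁻¹ : SL(n, ℂ)) : Matrix (Fin n) (Fin n) ℂ)
    * (g : Matrix (Fin n) (Fin n) ℂ) = g * A.1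
  rw [Matrix.mul_assoc, ← Matrix.SpecialLinearGroup.coe_mul, inv_mul_cancel,
    Matrix.SpecialLinearGroup.coe_one, Matrix.mul_one]

lemma adjointRep_eq {g : SL(n, ℂ)} {A B : LieAlgebra.SpecialLinear.sl (Fin n) ℂ}
    (h : (g : Matrix (Fin n) (Fin n) ℂ) * A.1 = B.1 * g) : adjointRep n g A = B := by
  refine Subtype.ext ?_
  have h1 := (adjointRep_mul g A).trans h
  have h2 := congrArg (· * ((g⁻¹ : SL(n, ℂ)) : Matrix (Fin n) (Fin n) ℂ)) h1
  simpa only [Matrix.mul_assoc, ← Matrix.SpecialLinearGroup.coe_mul, mul_inv_cancel,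
    Matrix.SpecialLinearGroup.coe_one, Matrix.mul_one] using h2

lemma adjointRep_monomialSL_apply (σ : Equiv.Perm (Fin n)) (ε : Fin n → ℂ)
    (h : ((Equiv.Perm.sign σ : ℤ) : ℂ) * ∏ i, ε i = 1)
    (A : LieAlgebra.SpecialLinear.sl (Fin n) ℂ) (i j : Fin n) :
    (adjointRep n (monomialSL σ ε h) A).1 i j * ε j = ε i * A.1 (σ i) (σ j) := by
  have H := congrFun (congrFun (adjointRep_mul (monomialSL σ ε h) A) i) (σ j)
  simpa [Matrix.mul_apply, monomialSL_apply, ite_mul, mul_ite] using H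

lemma ne_zero_of_mul_prod_eq_one {c : ℂ} {ε : Fin n → ℂ} (h : c * ∏ i, ε i = 1) (i : Fin n) :
    ε i ≠ 0 := by
  intro hi
  rw [Finset.prod_eq_zero (Finset.mem_univ i) hi, mul_zero] at h
  exact zero_ne_one h

lemma adjointRep_monomialSL_single (σ : Equiv.Perm (Fin n)) (ε : Fin n → ℂ)
    (h : ((Equiv.Perm.sign σ : ℤ) : ℂ) * ∏ i, ε i = 1) {i j : Fin n} (hij : i ≠ j)
    (hσij : σ i ≠ σ j) :
    adjointRep n (monomialSL σ ε h) (LieAlgebra.SpecialLinear.single (σ i) (σ j) hσij 1)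
      = (ε i / ε j) • LieAlgebra.SpecialLinear.single i j hij 1 := by
  refine Subtype.ext (Matrix.ext fun a b => ?_)
  refine mul_right_cancel₀ (ne_zero_of_mul_prod_eq_one h b) ?_
  rw [adjointRep_monomialSL_apply]
  have hj := ne_zero_of_mul_prod_eq_one h j
  by_cases hab : i = a ∧ j = b
  · obtain ⟨rfl, rfl⟩ := hab
    simp [hj]
  · simp [hab]

/-! ### Invariant subspaces of `𝔰𝔩ₙ`. -/

/-- A sign vector supported at `i₀` making the permutation matrix of `σ` unimodular. -/
lemma sign_mul_prod_update (σ : Equiv.Perm (Fin n)) (i₀ : Fin n) :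
    ((Equiv.Perm.sign σ : ℤ) : ℂ)
      * ∏ i, Function.update (fun _ => (1 : ℂ)) i₀ ((Equiv.Perm.sign σ : ℤ) : ℂ) i = 1 := by
  rw [Finset.prod_update_of_mem (Finset.mem_univ i₀)]
  rcases Int.units_eq_one_or (Equiv.Perm.sign σ) with h | h <;> simp [h]

lemma exists_perm_apply_eq {i j i₀ j₀ : Fin n} (hij : i ≠ j) (hij₀ : i₀ ≠ j₀) :
    ∃ σ : Equiv.Perm (Fin n), σ i = i₀ ∧ σ j = j₀ := by
  -- The right factor moves `j` to the preimage of `j₀` under the left factor; since `i₀ ≠ j₀` it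
  -- leaves `i` alone.
  refine ⟨Equiv.swap i i₀ * Equiv.swap j (Equiv.swap i i₀ j₀), ?_, ?_⟩
  · have h1 : i ≠ Equiv.swap i i₀ j₀ := by
      intro h
      have h2 := congrArg (Equiv.swap i i₀) h
      rw [Equiv.swap_apply_left, Equiv.swap_apply_self] at h2
      exact hij₀ h2
    rw [Equiv.Perm.mul_apply, Equiv.swap_apply_of_ne_of_ne hij h1, Equiv.swap_apply_left]
  · simp

lemma single_mem_of_invariant {S : Submodule ℂ (LieAlgebra.SpecialLinear.sl (Fin n) ℂ)}
    (hS : ∀ g, ∀ A ∈ S, adjointRep n g A ∈ S) {i₀ j₀ : Fin n} (hij₀ : i₀ ≠ j₀)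
    (h₀ : LieAlgebra.SpecialLinear.single i₀ j₀ hij₀ 1 ∈ S) {i j : Fin n} (hij : i ≠ j) :
    LieAlgebra.SpecialLinear.single i j hij (1 : ℂ) ∈ S := by
  obtain ⟨σ, rfl, rfl⟩ := exists_perm_apply_eq hij hij₀
  have h := sign_mul_prod_update σ i
  have h1 := hS (monomialSL σ _ h) _ h₀
  rw [adjointRep_monomialSL_single σ _ h hij] at h1
  exact (S.smul_mem_iff (div_ne_zero (ne_zero_of_mul_prod_eq_one h i)
    (ne_zero_of_mul_prod_eq_one h j))).1 h1

/-- This conjugation is how diagonal matrices are produced from off-diagonal ones. -/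
lemma adjointRep_transvection_single {i j : Fin n} (hij : i ≠ j) :
    adjointRep n (Matrix.SpecialLinearGroup.transvection hij.symm (1 : ℂ))
        (LieAlgebra.SpecialLinear.single i j hij 1)
      = LieAlgebra.SpecialLinear.single i j hij 1
        - LieAlgebra.SpecialLinear.singleSubSingle i j 1
        - LieAlgebra.SpecialLinear.single j i hij.symm 1 := by
  refine adjointRep_eq ?_
  simp [Matrix.SpecialLinearGroup.transvection_coe, Matrix.add_mul, Matrix.mul_add,
    Matrix.sub_mul, hij]
  abel

/-- An invariant subspace of `𝔰𝔩ₙ` containing an elementary matrix is everything. -/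
lemma eq_top_of_single_mem {S : Submodule ℂ (LieAlgebra.SpecialLinear.sl (Fin n) ℂ)}
    (hS : ∀ g, ∀ A ∈ S, adjointRep n g A ∈ S) {i₀ j₀ : Fin n} (hij₀ : i₀ ≠ j₀)
    (h₀ : LieAlgebra.SpecialLinear.single i₀ j₀ hij₀ 1 ∈ S) : S = ⊤ := by
  have hsingle {i j : Fin n} (hij : i ≠ j) (c : ℂ) :
      LieAlgebra.SpecialLinear.single i j hij c ∈ S := by
    have := S.smul_mem c (single_mem_of_invariant hS hij₀ h₀ hij)
    rwa [← map_smul, smul_eq_mul, mul_one] at this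
  have hdiag (i j : Fin n) (c : ℂ) : LieAlgebra.SpecialLinear.singleSubSingle i j c ∈ S := by
    by_cases hij : i = j
    · subst hij
      have : LieAlgebra.SpecialLinear.singleSubSingle i i c = 0 := Subtype.ext (by simp)
      rw [this]
      exact S.zero_mem
    · have h1 := hS (Matrix.SpecialLinearGroup.transvection (Ne.symm hij) (1 : ℂ)) _
        (hsingle hij 1)
      rw [adjointRep_transvection_single, S.sub_mem_iff_left (hsingle _ 1),
        S.sub_mem_iff_right (hsingle _ 1)] at h1
      have := S.smul_mem c h1
      rwa [← map_smul, smul_eq_mul, mul_one] at this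
  refine eq_top_iff.2 fun A _ => ?_
  -- The diagonal of `A` is written with the differences `E_ii - E_{i₀i₀}`; the total correction at
  -- `i₀` is the trace, which is zero.
  have hA : A = ∑ i, ∑ j, (if hij : i = j then
      LieAlgebra.SpecialLinear.singleSubSingle i i₀ (A.1 i i)
      else LieAlgebra.SpecialLinear.single i j hij (A.1 i j)) := by
    have htr : ∑ i, A.1 i i = 0 := A.2
    refine Subtype.ext ?_
    have h1 : ∀ i j, (if hij : i = j then
        LieAlgebra.SpecialLinear.singleSubSingle i i₀ (A.1 i i)
        else LieAlgebra.SpecialLinear.single i j hij (A.1 i j)).1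
        = Matrix.single i j (A.1 i j) - if i = j then Matrix.single i₀ i₀ (A.1 i i) else 0 := by
      intro i j
      split_ifs with hij
      · subst hij; simp
      · simp
    simp only [AddSubmonoidClass.coe_finsetSum, h1, Finset.sum_sub_distrib, Finset.sum_ite_eq,
      Finset.mem_univ, if_true]
    rw [← Matrix.matrix_eq_sum_single]
    have h2 : ∑ i, Matrix.single i₀ i₀ (A.1 i i) = (0 : Matrix (Fin n) (Fin n) ℂ) := by
      have := map_sum (Matrix.singleLinearMap ℂ i₀ i₀) (fun i => A.1 i i) Finset.univ
      rw [htr, map_zero] at this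
      exact this.symm
    rw [h2, sub_zero]
  rw [hA]
  refine S.sum_mem fun i _ => S.sum_mem fun j _ => ?_
  split_ifs with hij
  · exact hdiag _ _ _
  · exact hsingle _ _

/-- An invariant subspace of `𝔰𝔩ₙ` on which an off-diagonal entry vanishes is zero. -/
lemma eq_bot_of_entry_eq_zero {S : Submodule ℂ (LieAlgebra.SpecialLinear.sl (Fin n) ℂ)}
    (hS : ∀ g, ∀ A ∈ S, adjointRep n g A ∈ S) {i₀ j₀ : Fin n} (hij₀ : i₀ ≠ j₀)
    (h₀ : ∀ A ∈ S, A.1 i₀ j₀ = 0) : S = ⊥ := by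
  have hoff : ∀ A ∈ S, ∀ i j, i ≠ j → A.1 i j = 0 := by
    intro A hA i j hij
    obtain ⟨σ, rfl, rfl⟩ := exists_perm_apply_eq hij₀ hij
    have h := sign_mul_prod_update σ i₀
    have h1 := adjointRep_monomialSL_apply σ _ h A i₀ j₀
    rw [h₀ _ (hS _ A hA), zero_mul, eq_comm, mul_eq_zero] at h1
    exact h1.resolve_left (ne_zero_of_mul_prod_eq_one h i₀)
  refine eq_bot_iff.2 fun A hA => ?_
  -- `A` is diagonal, and so is its conjugate by `1 + E_ij`. The `(i, j)` and `(i, i)` entries of `B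
  -- g = g A` then identify `B i i` with both `A j j` and `A i i`. Thus `A` is scalar, and trace
  -- zero kills it.
  have hdiag : ∀ i j, A.1 i i = A.1 j j := by
    intro i j
    by_cases hij : i = j
    · rw [hij]
    have h1 := congrFun (congrFun (adjointRep_mul
      (Matrix.SpecialLinearGroup.transvection hij (1 : ℂ)) A) i) j
    have h2 := hoff _ (hS (Matrix.SpecialLinearGroup.transvection hij (1 : ℂ)) A hA)
    have h3 := congrFun (congrFun (adjointRep_mul
      (Matrix.SpecialLinearGroup.transvection hij (1 : ℂ)) A) i) i
    simp [Matrix.SpecialLinearGroup.transvection_coe, Matrix.mul_add, Matrix.add_mul,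
      hoff A hA _ _ hij, h2 _ _ hij, hij, hoff A hA _ _ (Ne.symm hij)] at h1 h3
    rw [← h3, h1]
  have htr : ∑ i, A.1 i i = 0 := A.2
  simp only [fun i => hdiag i i₀, Finset.sum_const, Finset.card_univ, Fintype.card_fin,
    nsmul_eq_mul, mul_eq_zero, Nat.cast_eq_zero] at htr
  rw [Submodule.mem_bot]
  refine Subtype.ext (Matrix.ext fun i j => ?_)
  by_cases hij : i = j
  · subst hij
    rw [hdiag i i₀]
    exact htr.resolve_left (Nat.pos_iff_ne_zero.1 (Fin.pos i₀))
  · exact hoff A hA i j hij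

/-! ### Weights, and the bound on the space of equivariant maps. -/

/-- The indices listed by `p` and `q` together contain `z` twice, omit `w`, and contain every other
index once. -/
def IsBalanced (z w : Fin n) (p : Fin k → Fin n) (q : Fin l → Fin n) : Prop :=
  ∀ y : Fin n → ℤ, ∑ c, y (p c) + ∑ c, y (q c) = ∑ i, y i + y z - y w

lemma IsBalanced.comp_perm {z w : Fin n} {p : Fin k → Fin n} {q : Fin l → Fin n}
    (h : IsBalanced z w p q) (α : Equiv.Perm (Fin k)) (β : Equiv.Perm (Fin l)) :
    IsBalanced z w (p ∘ α) (q ∘ β) := by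
  intro y
  rw [← h y, ← Equiv.sum_comp α (fun c => y (p c)), ← Equiv.sum_comp β (fun c => y (q c))]
  rfl

lemma prod_zpow_eq_zpow_sum {ι : Type*} (s : Finset ι) {a : ℂ} (ha : a ≠ 0) (y : ι → ℤ) :
    ∏ c ∈ s, a ^ y c = a ^ ∑ c ∈ s, y c := by
  classical
  induction s using Finset.induction_on with
  | empty => simp
  | insert i s hi ih => rw [Finset.prod_insert hi, Finset.sum_insert hi, zpow_add₀ ha, ih]

section Equivariant

variable {f : LieAlgebra.SpecialLinear.sl (Fin n) ℂ →ₗ[ℂ]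
    (⋀[ℂ]^k (Fin n → ℂ)) ⊗[ℂ] (⋀[ℂ]^l (Fin n → ℂ))}
  (hf : ∀ g A, f (adjointRep n g A) = (wedge n k).tprod (wedge n l) g (f A))

include hf

lemma minorProd_equivariant_single (σ : Equiv.Perm (Fin n)) (ε : Fin n → ℂ)
    (h : ((Equiv.Perm.sign σ : ℤ) : ℂ) * ∏ i, ε i = 1) {z w : Fin n} (hzw : z ≠ w)
    (hz : σ z = z) (hw : σ w = w) (p : Fin k → Fin n) (q : Fin l → Fin n) :
    ε z / ε w * minorProd p q (f (LieAlgebra.SpecialLinear.single z w hzw 1))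
      = (∏ j, ε (p j)) * (∏ j, ε (q j))
        * minorProd (σ ∘ p) (σ ∘ q) (f (LieAlgebra.SpecialLinear.single z w hzw 1)) := by
  rw [← minorProd_monomialSL σ ε h, ← hf]
  have h1 := adjointRep_monomialSL_single σ ε h hzw (by rwa [hz, hw])
  simp only [hz, hw] at h1
  rw [h1, map_smul, map_smul, smul_eq_mul]

/-- A diagonal matrix scales `E_zw` by `ε z / ε w` and the coordinate by the product of the listed
`ε`; where the coordinate is nonzero the two scalars agree. -/
lemma isBalanced_of_minorProd_ne_zero (hkl : k + l = n) {z w : Fin n} (hzw : z ≠ w)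
    {p : Fin k → Fin n} {q : Fin l → Fin n}
    (hpq : minorProd p q (f (LieAlgebra.SpecialLinear.single z w hzw 1)) ≠ 0) :
    IsBalanced z w p q := by
  have key : ∀ y : Fin n → ℤ, ∑ i, y i = 0 →
      ∑ c, y (p c) + ∑ c, y (q c) = y z - y w := by
    intro y hy
    have two : (2 : ℂ) ≠ 0 := two_ne_zero
    -- Powers of `2` turn equality of scalars into equality of integer exponents; `∑ y = 0` gives
    -- determinant one.
    have h := minorProd_equivariant_single hf 1 (fun i => 2 ^ y i)
      (by simp [prod_zpow_eq_zpow_sum _ two, hy]) hzw rfl rfl p q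
    have h1 := mul_right_cancel₀ hpq h
    rw [prod_zpow_eq_zpow_sum _ two, prod_zpow_eq_zpow_sum _ two, ← zpow_add₀ two,
      ← zpow_sub₀ two] at h1
    have h2 := congrArg norm h1
    rw [norm_zpow, norm_zpow, Complex.norm_ofNat] at h2
    exact (zpow_right_injective₀ (by norm_num) (by norm_num) h2).symm
  intro y
  have hn : (n : ℤ) ≠ 0 := by exact_mod_cast (Fin.pos z).ne'
  -- Projecting `n y` to sum zero removes the constraint on `y`. The lists have `k + l = n` entries
  -- in all, which restores the term `∑ y`.
  have h := key (fun i => n * y i - ∑ j, y j) (by simp [Finset.sum_sub_distrib, Finset.mul_sum])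
  simp only [Finset.sum_sub_distrib, ← Finset.mul_sum, Finset.sum_const, Finset.card_univ,
    Fintype.card_fin, nsmul_eq_mul] at h
  refine mul_left_cancel₀ hn ?_
  have hkl' : (n : ℤ) = k + l := by exact_mod_cast hkl.symm
  have e : (n : ℤ) * ∑ i, y i = k * ∑ i, y i + l * ∑ i, y i := by rw [hkl']; ring
  linear_combination h - e

/-- The permutation matrix of `σ` is made unimodular by placing `s = sign σ` in row `z`. It then
scales `E_zw` by `s`, while the lists, containing `z` twice, contribute `s² = 1`. -/
lemma minorProd_comp_of_isBalanced {z w : Fin n} (hzw : z ≠ w)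
    {p : Fin k → Fin n} {q : Fin l → Fin n} (hpq : IsBalanced z w p q)
    (σ : Equiv.Perm (Fin n)) (hz : σ z = z) (hw : σ w = w) :
    minorProd (σ ∘ p) (σ ∘ q) (f (LieAlgebra.SpecialLinear.single z w hzw 1))
      = ((Equiv.Perm.sign σ : ℤ) : ℂ)
        * minorProd p q (f (LieAlgebra.SpecialLinear.single z w hzw 1)) := by
  set s : ℂ := ((Equiv.Perm.sign σ : ℤ) : ℂ) with hs
  have hs2 : s ^ 2 = 1 := by
    rcases Int.units_eq_one_or (Equiv.Perm.sign σ) with h | h <;> simp [hs, h]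
  have hs0 : s ≠ 0 := by
    intro h
    simp [h] at hs2
  -- Writing the signs as powers of `s` lets the balance condition evaluate their product through
  -- the exponents.
  have hε : (fun i => s ^ (Pi.single z 1 : Fin n → ℤ) i)
      = Function.update (fun _ => (1 : ℂ)) z s := by
    funext i
    by_cases hi : i = z
    · subst hi; simp
    · simp [hi]
  have h := minorProd_equivariant_single hf σ (fun i => s ^ (Pi.single z 1 : Fin n → ℤ) i)
      (by rw [hε]; exact sign_mul_prod_update σ z) hzw hz hw p q
  rw [prod_zpow_eq_zpow_sum _ hs0, prod_zpow_eq_zpow_sum _ hs0, ← zpow_add₀ hs0, hpq] at h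
  simp only [Finset.sum_pi_single', Finset.mem_univ, if_true, Pi.single_eq_same,
    Pi.single_eq_of_ne hzw.symm, sub_zero, zpow_one, zpow_zero, div_one] at h
  rw [h]
  have : s ^ (1 + 1 : ℤ) = 1 := by exact_mod_cast hs2
  rw [this, one_mul]

end Equivariant

/-- The index `z` occurs twice in total and at most once in each injective list. -/
lemma IsBalanced.exists_apply_eq {z w : Fin n} (hzw : z ≠ w) {p : Fin k → Fin n}
    {q : Fin l → Fin n} (h : IsBalanced z w p q) (hp : Function.Injective p)
    (hq : Function.Injective q) : (∃ i, p i = z) ∧ ∃ j, q j = z := by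
  have h1 := h (Pi.single z 1)
  simp only [Pi.single_apply, Finset.sum_ite_eq', Finset.mem_univ, if_true, hzw.symm, if_false,
    Finset.sum_boole] at h1
  have card_le {m : ℕ} {r : Fin m → Fin n} (hr : Function.Injective r) :
      (Finset.univ.filter fun c => r c = z).card ≤ 1 :=
    Finset.card_le_one.2 fun a ha b hb => hr (by simp_all)
  have hp1 := card_le hp
  have hq1 := card_le hq
  have hp0 : 0 < (Finset.univ.filter fun c => p c = z).card := by omega
  have hq0 : 0 < (Finset.univ.filter fun c => q c = z).card := by omega
  obtain ⟨i, hi⟩ := Finset.card_pos.1 hp0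
  obtain ⟨j, hj⟩ := Finset.card_pos.1 hq0
  exact ⟨⟨i, by simpa using hi⟩, ⟨j, by simpa using hj⟩⟩

/-- An index missed by `e` would be detected by its indicator function; cardinalities do the rest.
-/
lemma bijective_of_sum_eq {T : Type*} [Fintype T] (hT : Fintype.card T = n) {e : T → Fin n}
    (he : ∀ y : Fin n → ℤ, ∑ t, y (e t) = ∑ i, y i) : Function.Bijective e := by
  refine (Fintype.bijective_iff_surjective_and_card e).2 ⟨fun v => ?_, by simpa using hT⟩
  by_contra hv
  push Not at hv
  have h := he (Pi.single v 1)
  simp [Pi.single_apply, hv] at h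

/-- An enumeration of all the indices obtained from a balanced pair of lists which both start
with `z`. -/
noncomputable def balancedEquiv {z w : Fin n} (hkl : k + 1 + (l + 1) = n) {p : Fin (k + 1) → Fin n}
    {q : Fin (l + 1) → Fin n} (h : IsBalanced z w p q) (hq : q 0 = z) :
    Fin (k + 1) ⊕ (Fin l ⊕ Unit) ≃ Fin n :=
  Equiv.ofBijective (Sum.elim p (Sum.elim (q ∘ Fin.succ) fun _ => w)) <|
    bijective_of_sum_eq (by simp; omega) fun y => by
      have := h y
      rw [Fin.sum_univ_succ (fun c => y (q c)), hq] at this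
      simp only [Fintype.sum_sum_type, Sum.elim_inl, Sum.elim_inr, Function.comp_apply,
        Finset.univ_unique, Finset.sum_const, Finset.card_singleton, one_smul]
      linarith

/-- Replacing the second `z` by the missing `w` turns each pair of lists into an enumeration of `Fin
n`; `σ` carries one enumeration to the other. -/
lemma IsBalanced.exists_perm {z w : Fin n} (hkl : k + 1 + (l + 1) = n)
    {p p' : Fin (k + 1) → Fin n} {q q' : Fin (l + 1) → Fin n}
    (h : IsBalanced z w p q) (h' : IsBalanced z w p' q') (hp : p 0 = z) (hq : q 0 = z)
    (hp' : p' 0 = z) (hq' : q' 0 = z) :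
    ∃ σ : Equiv.Perm (Fin n), σ z = z ∧ σ w = w ∧ σ ∘ p = p' ∧ σ ∘ q = q' := by
  set e := balancedEquiv hkl h hq
  set e' := balancedEquiv hkl h' hq'
  have hσ : ∀ t, (e.symm.trans e') (e t) = e' t := fun t => by simp
  have hz : (e.symm.trans e') z = z := by
    have := hσ (Sum.inl 0)
    rwa [show e (Sum.inl 0) = z from hp, show e' (Sum.inl 0) = z from hp'] at this
  refine ⟨e.symm.trans e', hz, hσ (Sum.inr (Sum.inr ())), funext fun c => hσ (Sum.inl c), ?_⟩
  refine funext fun c => Fin.cases ?_ (fun c => ?_) c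
  · rw [Function.comp_apply, hq, hz, hq']
  · exact hσ (Sum.inr (Sum.inl c))

lemma IsBalanced.exists_reorder {z w : Fin n} (hzw : z ≠ w) {p : Fin (k + 1) → Fin n}
    {q : Fin (l + 1) → Fin n} (h : IsBalanced z w p q) (hp : Function.Injective p)
    (hq : Function.Injective q) : ∃ (α : Equiv.Perm (Fin (k + 1))) (β : Equiv.Perm (Fin (l + 1))),
      (p ∘ α) 0 = z ∧ (q ∘ β) 0 = z := by
  obtain ⟨⟨i, hi⟩, j, hj⟩ := h.exists_apply_eq hzw hp hq
  exact ⟨Equiv.swap 0 i, Equiv.swap 0 j, by simpa using hi, by simpa using hj⟩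

lemma sign_mul_sign_ne_zero {α β : Type*} [Fintype α] [DecidableEq α] [Fintype β] [DecidableEq β]
    (σ : Equiv.Perm α) (τ : Equiv.Perm β) :
    ((Equiv.Perm.sign σ : ℤ) : ℂ) * ((Equiv.Perm.sign τ : ℤ) : ℂ) ≠ 0 :=
  mul_ne_zero (by simp) (by simp)

section Equivariant

variable {f : LieAlgebra.SpecialLinear.sl (Fin n) ℂ →ₗ[ℂ]
    (⋀[ℂ]^(k + 1) (Fin n → ℂ)) ⊗[ℂ] (⋀[ℂ]^(l + 1) (Fin n → ℂ))}
  (hf : ∀ g A, f (adjointRep n g A) = (wedge n (k + 1)).tprod (wedge n (l + 1)) g (f A))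

include hf

lemma exists_minorProd_ne_zero (hf0 : f ≠ 0) {z w : Fin n} (hzw : z ≠ w) :
    ∃ p q, minorProd p q (f (LieAlgebra.SpecialLinear.single z w hzw 1)) ≠ 0 := by
  by_contra! h
  refine hf0 (LinearMap.ker_eq_top.1 (eq_top_of_single_mem ?_ hzw ?_))
  · intro g A hA
    rw [LinearMap.mem_ker] at hA ⊢
    rw [hf, hA, map_zero]
  · exact eq_zero_of_minorProd_eq_zero h

/-- If some coordinate of `f E_zw` were nonzero, its lists would be balanced, hence conjugate to
`(p, q)` after reordering, and the two coordinates would agree up to sign. -/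
lemma equivariant_eq_zero (hkl : k + 1 + (l + 1) = n) {z w : Fin n} (hzw : z ≠ w)
    {p : Fin (k + 1) → Fin n} {q : Fin (l + 1) → Fin n} (hpq : IsBalanced z w p q)
    (hp : Function.Injective p) (hq : Function.Injective q)
    (h0 : minorProd p q (f (LieAlgebra.SpecialLinear.single z w hzw 1)) = 0) : f = 0 := by
  by_contra hf0
  obtain ⟨p', q', h'⟩ := exists_minorProd_ne_zero hf hf0 hzw
  have hb' := isBalanced_of_minorProd_ne_zero hf hkl hzw h'
  obtain ⟨hp', hq'⟩ := injective_of_minorProd_ne_zero h'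
  obtain ⟨α, β, hα, hβ⟩ := hpq.exists_reorder hzw hp hq
  obtain ⟨α', β', hα', hβ'⟩ := hb'.exists_reorder hzw hp' hq'
  obtain ⟨σ, hz, hw, hσp, hσq⟩ := (hpq.comp_perm α β).exists_perm hkl (hb'.comp_perm α' β')
    hα hβ hα' hβ'
  have h1 := minorProd_comp_of_isBalanced hf hzw (hpq.comp_perm α β) σ hz hw
  rw [hσp, hσq, minorProd_comp_perm, minorProd_comp_perm, LinearMap.smul_apply,
    LinearMap.smul_apply, h0, smul_zero, mul_zero, smul_eq_mul] at h1
  exact h' ((mul_eq_zero.1 h1).resolve_left (sign_mul_sign_ne_zero α' β'))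

/-- The space of equivariant maps from `𝔰𝔩ₙ` to `Λᵏ ℂⁿ ⊗ Λˡ ℂⁿ`, `k + l = n`, is at most
one-dimensional. -/
lemma eq_smul_of_equivariant (hkl : k + 1 + (l + 1) = n)
    {f' : LieAlgebra.SpecialLinear.sl (Fin n) ℂ →ₗ[ℂ]
      (⋀[ℂ]^(k + 1) (Fin n → ℂ)) ⊗[ℂ] (⋀[ℂ]^(l + 1) (Fin n → ℂ))}
    (hf' : ∀ g A, f' (adjointRep n g A) = (wedge n (k + 1)).tprod (wedge n (l + 1)) g (f' A))
    {z w : Fin n} (hzw : z ≠ w)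
    {p : Fin (k + 1) → Fin n} {q : Fin (l + 1) → Fin n}
    (hpq : minorProd p q (f (LieAlgebra.SpecialLinear.single z w hzw 1)) ≠ 0) :
    f' = (minorProd p q (f' (LieAlgebra.SpecialLinear.single z w hzw 1))
      / minorProd p q (f (LieAlgebra.SpecialLinear.single z w hzw 1))) • f := by
  have hb := isBalanced_of_minorProd_ne_zero hf hkl hzw hpq
  obtain ⟨hp, hq⟩ := injective_of_minorProd_ne_zero hpq
  set c := minorProd p q (f' (LieAlgebra.SpecialLinear.single z w hzw 1))
    / minorProd p q (f (LieAlgebra.SpecialLinear.single z w hzw 1)) with hc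
  have h : f' + (-c) • f = 0 := by
    refine equivariant_eq_zero (fun g A => ?_) hkl hzw hb hp hq ?_
    · simp only [LinearMap.add_apply, LinearMap.smul_apply, hf, hf', map_add, map_smul]
    · simp only [LinearMap.add_apply, LinearMap.smul_apply, map_add, map_smul, smul_eq_mul]
      rw [hc, neg_mul, div_mul_cancel₀ _ hpq, add_neg_cancel]
  refine LinearMap.ext fun A => ?_
  have hA := LinearMap.congr_fun h A
  rw [LinearMap.add_apply, LinearMap.smul_apply, LinearMap.zero_apply] at hA
  rw [LinearMap.smul_apply, ← zero_add (c • f A), ← hA, add_assoc, ← add_smul, neg_add_cancel,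
    zero_smul, add_zero]

end Equivariant

/-! ### The sign of the swap when `n = 2k`. -/

/-- An enumeration of all the indices by pairs, obtained from a balanced pair of lists which both
start with `z`. -/
noncomputable def balancedPairEquiv {z w : Fin n} (hk : k + 1 + (k + 1) = n)
    {p q : Fin (k + 1) → Fin n} (h : IsBalanced z w p q) (hp : p 0 = z) (hq : q 0 = z) :
    (Fin k × Bool) ⊕ Bool ≃ Fin n :=
  Equiv.ofBijective (Sum.elim (fun c => bif c.2 then p c.1.succ else q c.1.succ)
      fun b => bif b then z else w) <|
    bijective_of_sum_eq (by simp; omega) fun y => by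
      have := h y
      rw [Fin.sum_univ_succ (fun c => y (q c)), Fin.sum_univ_succ (fun c => y (p c)), hp, hq]
        at this
      simp only [Fintype.sum_sum_type, Sum.elim_inl, Sum.elim_inr, Fintype.sum_prod_type,
        Fintype.sum_bool, cond_true, cond_false, Finset.sum_add_distrib]
      linarith

lemma IsBalanced.exists_swap {z w : Fin n} (hk : k + 1 + (k + 1) = n)
    {p q : Fin (k + 1) → Fin n} (h : IsBalanced z w p q) (hp : p 0 = z) (hq : q 0 = z) :
    ∃ σ : Equiv.Perm (Fin n), σ z = z ∧ σ w = w ∧ σ ∘ p = q ∧ σ ∘ q = p ∧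
      Equiv.Perm.sign σ = (-1) ^ k := by
  set e := balancedPairEquiv hk h hp hq
  -- Exchanges the entries of `p` and `q` at each of the `k` positions after the first, and fixes
  -- `z` and `w`: a product of `k` transpositions.
  set τ : Equiv.Perm ((Fin k × Bool) ⊕ Bool) :=
    Equiv.Perm.sumCongr (Equiv.prodCongrRight fun _ => Equiv.swap true false) 1
  have hσ : ∀ t, e.permCongr τ (e t) = e (τ t) := fun t => by simp [Equiv.permCongr_apply]
  have hz : e.permCongr τ z = z := hσ (Sum.inr true)
  refine ⟨e.permCongr τ, hz, hσ (Sum.inr false), ?_, ?_, ?_⟩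
  · refine funext fun c => Fin.cases ?_ (fun c => ?_) c
    · rw [Function.comp_apply, hp, hz, hq]
    · exact hσ (Sum.inl (c, true))
  · refine funext fun c => Fin.cases ?_ (fun c => ?_) c
    · rw [Function.comp_apply, hq, hz, hp]
    · exact hσ (Sum.inl (c, false))
  · rw [Equiv.Perm.sign_permCongr, Equiv.Perm.sign_sumCongr, Equiv.Perm.sign_prodCongrRight]
    simp

/-- Exchanging the two tensor factors acts on the values of an equivariant map from `𝔰𝔩₂ₖ` to
`Λᵏ ℂ²ᵏ ⊗ Λᵏ ℂ²ᵏ` by the sign `(-1)ᵏ⁻¹`. -/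
lemma comm_comp_equivariant {f : LieAlgebra.SpecialLinear.sl (Fin n) ℂ →ₗ[ℂ]
      (⋀[ℂ]^(k + 1) (Fin n → ℂ)) ⊗[ℂ] (⋀[ℂ]^(k + 1) (Fin n → ℂ))}
    (hf : ∀ g A, f (adjointRep n g A) = (wedge n (k + 1)).tprod (wedge n (k + 1)) g (f A))
    (hk : k + 1 + (k + 1) = n) (hf0 : f ≠ 0) :
    (TensorProduct.comm ℂ _ _).toLinearMap ∘ₗ f = ((-1) ^ k : ℂ) • f := by
  have hzw : (⟨0, by omega⟩ : Fin n) ≠ ⟨1, by omega⟩ := by simp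
  obtain ⟨p, q, hpq⟩ := exists_minorProd_ne_zero hf hf0 hzw
  have hb := isBalanced_of_minorProd_ne_zero hf hk hzw hpq
  obtain ⟨hp, hq⟩ := injective_of_minorProd_ne_zero hpq
  have hf' : ∀ g A, ((TensorProduct.comm ℂ _ _).toLinearMap ∘ₗ f) (adjointRep n g A)
      = (wedge n (k + 1)).tprod (wedge n (k + 1)) g
        (((TensorProduct.comm ℂ _ _).toLinearMap ∘ₗ f) A) := by
    intro g A
    simp only [LinearMap.comp_apply, hf, LinearEquiv.coe_coe, Representation.tprod_apply]
    exact (TensorProduct.map_comm _ _ _).symm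
  rw [eq_smul_of_equivariant hf hk hf' hzw hpq]
  congr 1
  rw [div_eq_iff hpq, LinearMap.comp_apply, LinearEquiv.coe_coe, minorProd_comm]
  obtain ⟨α, β, hα, hβ⟩ := hb.exists_reorder hzw hp hq
  obtain ⟨σ, hz, hw, hσp, hσq, hs⟩ := (hb.comp_perm α β).exists_swap hk hα hβ
  have h1 := minorProd_comp_of_isBalanced hf hzw (hb.comp_perm α β) σ hz hw
  rw [hσp, hσq, minorProd_comp_perm, minorProd_comp_perm, LinearMap.smul_apply,
    LinearMap.smul_apply, smul_eq_mul, smul_eq_mul, hs] at h1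
  -- The reorderings contribute the same product of signs on both sides.
  refine mul_left_cancel₀ (sign_mul_sign_ne_zero β α) (h1.trans ?_)
  push_cast
  ring

/-! ### The wedge pairing and the duality of `Λˡ` and `Λᵏ`. -/

/-- The linear form on the exterior algebra of `ℂⁿ` which is the determinant in degree `n` and
zero in the other degrees. -/
noncomputable def volumeForm (n : ℕ) : ExteriorAlgebra ℂ (Fin n → ℂ) →ₗ[ℂ] ℂ :=
  ExteriorAlgebra.liftAlternating
    (Pi.single (M := fun i => (Fin n → ℂ) [⋀^Fin i]→ₗ[ℂ] ℂ) n Matrix.detRowAlternating)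

/-- The pairing `(η, ω) ↦ η ∧ ω` of `Λˡ ℂⁿ` and `Λᵏ ℂⁿ`, with values in `Λⁿ ℂⁿ = ℂ` if
`l + k = n`. -/
noncomputable def wedgePairing (n l k : ℕ) :
    ⋀[ℂ]^l (Fin n → ℂ) →ₗ[ℂ] Dual ℂ (⋀[ℂ]^k (Fin n → ℂ)) :=
  ((LinearMap.mul ℂ (ExteriorAlgebra ℂ (Fin n → ℂ))).compl₁₂ (Submodule.subtype _)
    (Submodule.subtype _)).compr₂ (volumeForm n)

lemma ιMulti_mul_ιMulti {V : Type*} [AddCommGroup V] [Module ℂ V] (v : Fin l → V) (u : Fin k → V) :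
    ExteriorAlgebra.ιMulti ℂ l v * ExteriorAlgebra.ιMulti ℂ k u
      = ExteriorAlgebra.ιMulti ℂ (l + k) (Fin.append v u) := by
  rw [ExteriorAlgebra.ιMulti_apply, ExteriorAlgebra.ιMulti_apply, ExteriorAlgebra.ιMulti_apply,
    ← List.prod_append, ← List.ofFn_fin_append]
  congr 2
  funext i
  refine Fin.addCases (fun i => ?_) (fun i => ?_) i <;> simp

lemma wedgePairing_ιMulti (h : l + k = n) (v : Fin l → Fin n → ℂ) (u : Fin k → Fin n → ℂ) :
    wedgePairing n l k (exteriorPower.ιMulti ℂ l v) (exteriorPower.ιMulti ℂ k u)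
      = (Matrix.of fun i => Fin.append v u (Fin.cast h.symm i)).det := by
  subst h
  change volumeForm (l + k) (ExteriorAlgebra.ιMulti ℂ l v * ExteriorAlgebra.ιMulti ℂ k u) = _
  rw [ιMulti_mul_ιMulti, volumeForm, ExteriorAlgebra.liftAlternating_apply_ιMulti,
    Pi.single_eq_same]
  rfl

lemma wedgePairing_wedge (h : l + k = n) (g : SL(n, ℂ)) (η : ⋀[ℂ]^l (Fin n → ℂ))
    (ω : ⋀[ℂ]^k (Fin n → ℂ)) :
    wedgePairing n l k (wedge n l g η) (wedge n k g ω) = wedgePairing n l k η ω := by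
  suffices H : (wedgePairing n l k).compl₁₂ (wedge n l g) (wedge n k g) = wedgePairing n l k from
    LinearMap.congr_fun₂ H η ω
  refine exteriorPower.linearMap_ext (AlternatingMap.ext fun v =>
    exteriorPower.linearMap_ext (AlternatingMap.ext fun u => ?_))
  simp only [LinearMap.compAlternatingMap_apply, LinearMap.compl₁₂_apply, wedge_ιMulti,
    wedgePairing_ιMulti h]
  have hg : (g : Matrix (Fin n) (Fin n) ℂ)ᵀ.det = 1 := by
    rw [Matrix.det_transpose]
    exact g.2
  rw [← mul_one (Matrix.det (Matrix.of fun i => Fin.append v u (Fin.cast h.symm i))), ← hg,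
    ← Matrix.det_mul]
  congr 1
  ext i j
  have : Fin.append (fun i => stdRep n g (v i)) (fun i => stdRep n g (u i))
      = fun i => stdRep n g (Fin.append v u i) := by
    funext i
    refine Fin.addCases (fun i => ?_) (fun i => ?_) i <;> simp
  rw [this]
  simp [stdRep, Matrix.toLin'_apply, Matrix.mulVec, dotProduct, Matrix.mul_apply, mul_comm]

lemma exists_complement (h : l + k = n) {q : Fin l → Fin n} (hq : Function.Injective q) :
    ∃ p : Fin k → Fin n, Function.Bijective (Sum.elim q p) := by
  classical
  have hcard : Fintype.card {i // i ∉ Set.range q} = k := by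
    rw [Fintype.card_subtype_compl, Fintype.card_fin]
    have : Fintype.card {i // i ∈ Set.range q} = l :=
      (Fintype.card_congr (Equiv.ofInjective q hq).symm).trans (Fintype.card_fin l)
    omega
  let e := Fintype.equivFinOfCardEq hcard
  refine ⟨fun i => (e.symm i).1, (Fintype.bijective_iff_injective_and_card _).2 ⟨?_, by simpa⟩⟩
  refine Function.Injective.sumElim hq (Subtype.val_injective.comp e.symm.injective) ?_
  intro a b hab
  exact (e.symm b).2 ⟨a, hab⟩

/-- Wedging with the basis vectors of the complementary indices extracts a minor up to sign. This
makes the pairing nondegenerate. -/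
lemma minorForm_eq_smul_wedgePairing (h : l + k = n) {q : Fin l → Fin n} {p : Fin k → Fin n}
    (hqp : Function.Bijective (Sum.elim q p)) :
    ∃ s : ℂ, ∀ η, minorForm q η = s * wedgePairing n l k η
      (exteriorPower.ιMulti ℂ k fun i => Pi.single (p i) 1) := by
  let e := Equiv.ofBijective _ hqp
  let f : Fin l ⊕ Fin k ≃ Fin n := finSumFinEquiv.trans (finCongr h)
  refine ⟨((Equiv.Perm.sign (f.symm.trans e) : ℤ) : ℂ), fun η => ?_⟩
  suffices H : minorForm q = ((Equiv.Perm.sign (f.symm.trans e) : ℤ) : ℂ) •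
      (wedgePairing n l k).flip (exteriorPower.ιMulti ℂ k fun i => Pi.single (p i) 1) by
    rw [H]; rfl
  refine exteriorPower.linearMap_ext (AlternatingMap.ext fun v => ?_)
  simp only [LinearMap.compAlternatingMap_apply, LinearMap.smul_apply, LinearMap.flip_apply,
    wedgePairing_ιMulti h, minorForm_ιMulti, smul_eq_mul]
  rw [← Matrix.det_permute', ← Matrix.det_submatrix_equiv_self f, Matrix.submatrix_submatrix]
  -- With the columns reordered as `q` followed by `p`, the appended basis vectors form the rows `(0
  -- 1)`.
  have key : (Matrix.of fun i => Fin.append v (fun i => (Pi.single (p i) 1 : Fin n → ℂ))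
      (Fin.cast h.symm i)).submatrix (id ∘ f) ((f.symm.trans e) ∘ f)
      = Matrix.fromBlocks (Matrix.of fun i j => v i (q j)) (Matrix.of fun i j => v i (p j)) 0 1 := by
    have hinj : Function.Injective p := fun a b hab => by
      simpa using hqp.1 (a₁ := Sum.inr a) (a₂ := Sum.inr b) hab
    have hne : ∀ i j, q j ≠ p i := fun i j hij => by
      simpa using hqp.1 (a₁ := Sum.inl j) (a₂ := Sum.inr i) hij
    ext a b
    rcases a with i | i <;> rcases b with j | j <;>
      simp [f, e, Matrix.one_apply, Pi.single_apply, hinj.eq_iff, hne, eq_comm]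
  rw [key, Matrix.det_fromBlocks_zero₂₁, Matrix.det_one, mul_one]

lemma wedgePairing_injective (h : l + k = n) : Function.Injective (wedgePairing n l k) := by
  refine (injective_iff_map_eq_zero _).2 fun η hη => eq_zero_of_minorForm_eq_zero fun q hq => ?_
  obtain ⟨p, hp⟩ := exists_complement h hq
  obtain ⟨s, hs⟩ := minorForm_eq_smul_wedgePairing h hp
  rw [hs, hη, LinearMap.zero_apply, mul_zero]

/-- The isomorphism of `Λˡ ℂⁿ` with the dual of `Λᵏ ℂⁿ`, for `l + k = n`. -/
noncomputable def wedgeDualEquiv (h : l + k = n) :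
    ⋀[ℂ]^l (Fin n → ℂ) ≃ₗ[ℂ] Dual ℂ (⋀[ℂ]^k (Fin n → ℂ)) :=
  LinearMap.linearEquivOfInjective (wedgePairing n l k) (wedgePairing_injective h) (by
    rw [Subspace.dual_finrank_eq, exteriorPower.finrank_eq, exteriorPower.finrank_eq,
      Module.finrank_fin_fun]
    exact (Nat.choose_symm_of_eq_add h.symm))

lemma wedgeDualEquiv_apply (h : l + k = n) (η : ⋀[ℂ]^l (Fin n → ℂ)) :
    wedgeDualEquiv h η = wedgePairing n l k η := rfl

lemma nonempty_wedge_equiv_dual (h : l + k = n) :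
    Nonempty ((wedge n l).Equiv (wedge n k).dual) := by
  refine ⟨Representation.Equiv.mk (wedgeDualEquiv h) fun g => LinearMap.ext fun η =>
    LinearMap.ext fun ω => ?_⟩
  change wedgePairing n l k (wedge n l g η) ω = wedgePairing n l k η (wedge n k g⁻¹ ω)
  rw [← wedgePairing_wedge h g η, ← Module.End.mul_apply, ← map_mul, mul_inv_cancel, map_one,
    Module.End.one_apply]

/-! ### The derivation action and the embedding of `𝔰𝔩ₙ`. -/

section Derivation

variable {V : Type*} [AddCommGroup V] [Module ℂ V]

lemma sum_compLinearMap_update_apply (a : V →ₗ[ℂ] V) (v : Fin k → V) :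
    (∑ i, (exteriorPower.ιMulti ℂ k (M := V)).toMultilinearMap.compLinearMap
        (Function.update (fun _ => LinearMap.id) i a)) v
      = ∑ i, exteriorPower.ιMulti ℂ k (Function.update v i (a (v i))) := by
  rw [_root_.sum_apply]
  refine Finset.sum_congr rfl fun i _ => ?_
  rw [MultilinearMap.compLinearMap_apply]
  refine congrArg (exteriorPower.ιMulti ℂ k) (funext fun j => ?_)
  by_cases hj : j = i
  · subst hj; simp
  · simp [hj]

/-- The alternating map `v ↦ ∑ᵢ v₁ ∧ ⋯ ∧ a vᵢ ∧ ⋯ ∧ vₖ`. -/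
noncomputable def derivAlternating (k : ℕ) (a : V →ₗ[ℂ] V) : V [⋀^Fin k]→ₗ[ℂ] ⋀[ℂ]^k V :=
  { ∑ i, (exteriorPower.ιMulti ℂ k (M := V)).toMultilinearMap.compLinearMap
        (Function.update (fun _ => LinearMap.id) i a) with
    map_eq_zero_of_eq' := fun v i j hij hne => by
      change (∑ i, (exteriorPower.ιMulti ℂ k (M := V)).toMultilinearMap.compLinearMap
        (Function.update (fun _ => LinearMap.id) i a)) v = 0
      -- When `v i = v j`, every other summand keeps the repeated vector and vanishes; the two
      -- remaining ones differ by a transposition and cancel.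
      rw [sum_compLinearMap_update_apply, Fintype.sum_eq_add i j hne]
      · have : Function.update v j (a (v j))
            = Function.update v i (a (v i)) ∘ Equiv.swap i j := by
          funext m
          by_cases hmi : m = i
          · subst hmi; simp [hne, hne.symm, hij]
          by_cases hmj : m = j
          · subst hmj; simp [hij]
          simp [Equiv.swap_apply_of_ne_of_ne hmi hmj, hmi, hmj]
        rw [this]
        exact (exteriorPower.ιMulti ℂ k).map_add_swap _ hne
      · rintro m ⟨hmi, hmj⟩
        exact (exteriorPower.ιMulti ℂ k).map_eq_zero_of_eq _
          (by simp [Ne.symm hmi, Ne.symm hmj, hij]) hne }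

lemma derivAlternating_apply (a : V →ₗ[ℂ] V) (v : Fin k → V) :
    derivAlternating k a v = ∑ i, exteriorPower.ιMulti ℂ k (Function.update v i (a (v i))) :=
  sum_compLinearMap_update_apply a v

/-- The action of `End V` on `Λᵏ V` by derivations. -/
noncomputable def extDeriv (V : Type*) [AddCommGroup V] [Module ℂ V] (k : ℕ) :
    (V →ₗ[ℂ] V) →ₗ[ℂ] (⋀[ℂ]^k V →ₗ[ℂ] ⋀[ℂ]^k V) where
  toFun a := exteriorPower.alternatingMapLinearEquiv (derivAlternating k a)
  map_add' a b := by
    refine exteriorPower.linearMap_ext (AlternatingMap.ext fun v => ?_)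
    simp only [LinearMap.compAlternatingMap_apply, LinearMap.add_apply,
      exteriorPower.alternatingMapLinearEquiv_apply_ιMulti, derivAlternating_apply,
      AlternatingMap.map_update_add, Finset.sum_add_distrib]
  map_smul' c a := by
    refine exteriorPower.linearMap_ext (AlternatingMap.ext fun v => ?_)
    simp only [LinearMap.compAlternatingMap_apply, LinearMap.smul_apply, RingHom.id_apply,
      exteriorPower.alternatingMapLinearEquiv_apply_ιMulti, derivAlternating_apply,
      AlternatingMap.map_update_smul, Finset.smul_sum]

lemma extDeriv_ιMulti (a : V →ₗ[ℂ] V) (v : Fin k → V) :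
    extDeriv V k a (exteriorPower.ιMulti ℂ k v)
      = ∑ i, exteriorPower.ιMulti ℂ k (Function.update v i (a (v i))) :=
  (exteriorPower.alternatingMapLinearEquiv_apply_ιMulti _ v).trans (derivAlternating_apply a v)

lemma extDeriv_comp_map {a b g : V →ₗ[ℂ] V} (h : b ∘ₗ g = g ∘ₗ a) :
    extDeriv V k b ∘ₗ exteriorPower.map k g = exteriorPower.map k g ∘ₗ extDeriv V k a := by
  refine exteriorPower.linearMap_ext (AlternatingMap.ext fun v => ?_)
  simp only [LinearMap.compAlternatingMap_apply, LinearMap.comp_apply, extDeriv_ιMulti, map_sum,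
    exteriorPower.map_apply_ιMulti]
  refine Finset.sum_congr rfl fun i _ => congrArg _ (funext fun j => ?_)
  have hi := LinearMap.congr_fun h (v i)
  simp only [LinearMap.comp_apply] at hi
  by_cases hj : j = i
  · subst hj; simpa using hi
  · simp [hj]

end Derivation

/-- Recovers a matrix entry from the derivation. Summands with `i ≠ 0` keep `e_{p 0}`, whose tested
coordinates all vanish; the summand `i = 0` has a triangular minor with diagonal `a(e_{p 0})_w, 1,
…, 1`. -/
lemma minorForm_extDeriv (a : (Fin n → ℂ) →ₗ[ℂ] (Fin n → ℂ)) {p : Fin (k + 1) → Fin n}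
    (hp : Function.Injective p) {w : Fin n} (hw : ∀ i, p i ≠ w) :
    minorForm (Function.update p 0 w)
        (extDeriv _ (k + 1) a (exteriorPower.ιMulti ℂ (k + 1) fun i => Pi.single (p i) 1))
      = a (Pi.single (p 0) 1) w := by
  rw [extDeriv_ιMulti, map_sum, Fintype.sum_eq_single 0, minorForm_ιMulti,
    Matrix.det_of_isUpperTriangular, Fin.prod_univ_succ]
  · simp
  · intro i j hij
    have hi : i ≠ 0 := (lt_of_le_of_lt (Fin.zero_le _) hij).ne'
    by_cases hj : j = 0
    · subst hj
      simp [hi, (hw i).symm]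
    · have : p j ≠ p i := fun h => (ne_of_lt hij) (hp h)
      simp [hi, hj, this]
  · intro i hi
    rw [minorForm_ιMulti]
    refine Matrix.det_eq_zero_of_row_eq_zero 0 fun j => ?_
    by_cases hj : j = 0
    · subst hj
      simp [hi.symm, (hw 0).symm]
    · have : p j ≠ p 0 := fun h => hj (hp h)
      simp [hi.symm, hj, this]

/-- The isomorphism of `Λᵏ ℂⁿ ⊗ Λˡ ℂⁿ` with the endomorphisms of `Λᵏ ℂⁿ`, for `l + k = n`. -/
noncomputable def wedgeTensorEquiv (h : l + k = n) :
    (⋀[ℂ]^k (Fin n → ℂ)) ⊗[ℂ] (⋀[ℂ]^l (Fin n → ℂ))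
      ≃ₗ[ℂ] (⋀[ℂ]^k (Fin n → ℂ) →ₗ[ℂ] ⋀[ℂ]^k (Fin n → ℂ)) :=
  (TensorProduct.comm ℂ _ _ ≪≫ₗ TensorProduct.congr (wedgeDualEquiv h) (LinearEquiv.refl ℂ _)) ≪≫ₗ
    dualTensorHomEquiv ℂ _ _

lemma wedgeTensorEquiv_tmul (h : l + k = n) (ω ζ : ⋀[ℂ]^k (Fin n → ℂ)) (η : ⋀[ℂ]^l (Fin n → ℂ)) :
    wedgeTensorEquiv h (ω ⊗ₜ η) ζ = wedgePairing n l k η ζ • ω := by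
  simp [wedgeTensorEquiv, wedgeDualEquiv_apply]

lemma wedgeTensorEquiv_tprod (h : l + k = n) (g : SL(n, ℂ))
    (x : (⋀[ℂ]^k (Fin n → ℂ)) ⊗[ℂ] (⋀[ℂ]^l (Fin n → ℂ))) (ζ : ⋀[ℂ]^k (Fin n → ℂ)) :
    wedgeTensorEquiv h ((wedge n k).tprod (wedge n l) g x) (wedge n k g ζ)
      = wedge n k g (wedgeTensorEquiv h x ζ) := by
  induction x with
  | zero => simp
  | add x y hx hy => simp only [map_add, LinearMap.add_apply, hx, hy]
  | tmul ω η =>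
    rw [Representation.tprod_apply, TensorProduct.map_tmul, wedgeTensorEquiv_tmul,
      wedgeTensorEquiv_tmul, wedgePairing_wedge h, map_smul]

/-- The inclusion of `𝔰𝔩ₙ` into the matrices, as a linear map. -/
def slInclusion (n : ℕ) :
    LieAlgebra.SpecialLinear.sl (Fin n) ℂ →ₗ[ℂ] Matrix (Fin n) (Fin n) ℂ where
  toFun A := A.1
  map_add' _ _ := rfl
  map_smul' _ _ := rfl

/-- The equivariant embedding of `𝔰𝔩ₙ` into `Λᵏ ℂⁿ ⊗ Λˡ ℂⁿ`, for `l + k = n`, given by the action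
of `𝔰𝔩ₙ` on `Λᵏ ℂⁿ`. -/
noncomputable def adjointEmbedding (h : l + k = n) :
    LieAlgebra.SpecialLinear.sl (Fin n) ℂ →ₗ[ℂ]
      (⋀[ℂ]^k (Fin n → ℂ)) ⊗[ℂ] (⋀[ℂ]^l (Fin n → ℂ)) :=
  (wedgeTensorEquiv h).symm.toLinearMap ∘ₗ extDeriv _ k ∘ₗ
    (Matrix.toLin' : Matrix (Fin n) (Fin n) ℂ ≃ₗ[ℂ] _).toLinearMap ∘ₗ
      slInclusion n

lemma wedgeTensorEquiv_adjointEmbedding (h : l + k = n)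
    (A : LieAlgebra.SpecialLinear.sl (Fin n) ℂ) :
    wedgeTensorEquiv h (adjointEmbedding h A) = extDeriv _ k (Matrix.toLin' A.1) :=
  (wedgeTensorEquiv h).apply_symm_apply _

lemma adjointEmbedding_adjointRep (h : l + k = n) (g : SL(n, ℂ))
    (A : LieAlgebra.SpecialLinear.sl (Fin n) ℂ) :
    adjointEmbedding h (adjointRep n g A)
      = (wedge n k).tprod (wedge n l) g (adjointEmbedding h A) := by
  refine (wedgeTensorEquiv h).injective (LinearMap.ext fun ζ => ?_)
  obtain ⟨ζ, rfl⟩ : ∃ ξ, wedge n k g ξ = ζ := ⟨wedge n k g⁻¹ ζ, by simp⟩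
  rw [wedgeTensorEquiv_tprod, wedgeTensorEquiv_adjointEmbedding,
    wedgeTensorEquiv_adjointEmbedding]
  refine LinearMap.congr_fun (extDeriv_comp_map (g := stdRep n g) ?_) ζ
  change Matrix.toLin' _ ∘ₗ Matrix.toLin' _ = Matrix.toLin' _ ∘ₗ Matrix.toLin' _
  rw [← Matrix.toLin'_mul, ← Matrix.toLin'_mul, adjointRep_mul]

lemma adjointEmbedding_injective (hk : 0 < k) (hl : 0 < l) (h : l + k = n) :
    Function.Injective (adjointEmbedding h) := by
  obtain ⟨k, rfl⟩ := Nat.exists_eq_succ_of_ne_zero hk.ne'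
  -- An index `w` outside `p` exists because `l > 0`. The derivation then determines the `(w, p 0)`
  -- entry, which therefore vanishes on the invariant kernel.
  let p : Fin (k + 1) → Fin n := Fin.castLE (by omega)
  let w : Fin n := ⟨k + 1, by omega⟩
  have hp : Function.Injective p := Fin.castLE_injective _
  have hw : ∀ i, p i ≠ w := fun i hi => by
    have := congrArg Fin.val hi
    simp only [p, w, Fin.val_castLE] at this
    omega
  suffices H : LinearMap.ker (adjointEmbedding h) = ⊥ from
    (injective_iff_map_eq_zero _).2 fun A hA => (Submodule.mem_bot ℂ).1 (H ▸ LinearMap.mem_ker.2 hA)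
  refine eq_bot_of_entry_eq_zero (fun g A hA => ?_) (hw 0).symm fun A hA => ?_
  · rw [LinearMap.mem_ker] at hA ⊢
    rw [adjointEmbedding_adjointRep, hA, map_zero]
  · have h1 := wedgeTensorEquiv_adjointEmbedding h A
    rw [LinearMap.mem_ker.1 hA, map_zero] at h1
    have h2 := minorForm_extDeriv (Matrix.toLin' A.1) hp hw
    rw [← h1, LinearMap.zero_apply, map_zero] at h2
    simpa using h2.symm

/-! ### Copies of `𝔰𝔩ₙ` as ranges of equivariant maps. -/

/-- The range of an equivariant linear map, as a subrepresentation. -/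
def rangeSubrep {G U V : Type*} [Group G] [AddCommMonoid U] [Module ℂ U] [AddCommMonoid V]
    [Module ℂ V] {ρ : Representation ℂ G U} {σ : Representation ℂ G V} (f : U →ₗ[ℂ] V)
    (hf : ∀ g u, f (ρ g u) = σ g (f u)) : Subrepresentation σ where
  toSubmodule := LinearMap.range f
  apply_mem_toSubmodule g v hv := by
    obtain ⟨u, rfl⟩ := hv
    exact ⟨ρ g u, hf g u⟩

lemma isCopyOf_rangeSubrep {G U V : Type*} [Group G] [AddCommMonoid U] [Module ℂ U]
    [AddCommMonoid V] [Module ℂ V] {ρ : Representation ℂ G U} {σ : Representation ℂ G V}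
    (f : U →ₗ[ℂ] V) (hf : ∀ g u, f (ρ g u) = σ g (f u)) (hinj : Function.Injective f) :
    IsCopyOf (rangeSubrep f hf) ρ :=
  ⟨(Representation.Equiv.mk (ρ := ρ) (σ := (rangeSubrep f hf).toRepresentation)
    (LinearEquiv.ofInjective f hinj) fun g =>
      LinearMap.ext fun u => Subtype.ext (hf g u)).symm⟩

lemma IsCopyOf.exists_equivariant {G U V : Type*} [Group G] [AddCommMonoid U] [Module ℂ U]
    [AddCommMonoid V] [Module ℂ V] {ρ : Representation ℂ G U} {σ : Representation ℂ G V}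
    {W : Subrepresentation σ} (hW : IsCopyOf W ρ) :
    ∃ f : U →ₗ[ℂ] V, (∀ g u, f (ρ g u) = σ g (f u)) ∧ Function.Injective f ∧
      LinearMap.range f = W.toSubmodule := by
  obtain ⟨e⟩ := hW
  refine ⟨W.toSubmodule.subtype ∘ₗ e.symm.toLinearEquiv.toLinearMap, fun g u => ?_, ?_, ?_⟩
  · exact congrArg Subtype.val (LinearMap.congr_fun (e.symm.isIntertwining' g) u)
  · exact Subtype.val_injective.comp e.symm.toLinearEquiv.injective
  · rw [LinearMap.range_comp, LinearEquiv.range, Submodule.map_top, Submodule.range_subtype]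

/-- The inclusion of a copy is a nonzero multiple of `adjointEmbedding`, and such a multiple has the
same range. -/
lemma isCopyOf_adjointRep_unique (hkl : l + 1 + (k + 1) = n)
    {W : Subrepresentation ((wedge n (k + 1)).tprod (wedge n (l + 1)))}
    (hW : IsCopyOf W (adjointRep n)) :
    W = rangeSubrep (adjointEmbedding hkl) (adjointEmbedding_adjointRep hkl) := by
  have hinj := adjointEmbedding_injective k.succ_pos l.succ_pos hkl
  have hzw : (⟨0, by omega⟩ : Fin n) ≠ ⟨1, by omega⟩ := by simp
  set E := LieAlgebra.SpecialLinear.single _ _ hzw (1 : ℂ) with hE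
  have hE0 : E ≠ 0 := fun h => by
    have := congrFun (congrFun (congrArg Subtype.val h) ⟨0, by omega⟩) ⟨1, by omega⟩
    simp [hE] at this
  have ne_zero_of_injective {f : LieAlgebra.SpecialLinear.sl (Fin n) ℂ →ₗ[ℂ]
      (⋀[ℂ]^(k + 1) (Fin n → ℂ)) ⊗[ℂ] (⋀[ℂ]^(l + 1) (Fin n → ℂ))} (hf : Function.Injective f) :
      f ≠ 0 := by
    rintro rfl
    exact hE0 (hf (by simp))
  obtain ⟨f', hf', hinj', hrange⟩ := hW.exists_equivariant
  obtain ⟨p, q, hpq⟩ := exists_minorProd_ne_zero (adjointEmbedding_adjointRep hkl)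
    (ne_zero_of_injective hinj) hzw
  have h := eq_smul_of_equivariant (adjointEmbedding_adjointRep hkl) (by omega) hf' hzw hpq
  refine Subrepresentation.toSubmodule_injective ?_
  rw [← hrange, h]
  refine LinearMap.range_smul _ _ fun h0 => ne_zero_of_injective hinj' ?_
  rw [h, h0, zero_smul]

lemma existsUnique_isCopyOf_adjointRep (hk : 0 < k) (hl : 0 < l) (hkl : k + l = n) :
    ∃! W : Subrepresentation ((wedge n k).tprod (wedge n l)), IsCopyOf W (adjointRep n) := by
  obtain ⟨k, rfl⟩ := Nat.exists_eq_succ_of_ne_zero hk.ne'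
  obtain ⟨l, rfl⟩ := Nat.exists_eq_succ_of_ne_zero hl.ne'
  have hlk : l + 1 + (k + 1) = n := by omega
  exact ⟨rangeSubrep (adjointEmbedding hlk) (adjointEmbedding_adjointRep hlk),
    isCopyOf_rangeSubrep _ _ (adjointEmbedding_injective k.succ_pos l.succ_pos hlk),
    fun W hW => isCopyOf_adjointRep_unique hlk hW⟩

lemma comm_eq_of_mem_isCopyOf (hk : k + 1 + (k + 1) = n)
    {W : Subrepresentation ((wedge n (k + 1)).tprod (wedge n (k + 1)))}
    (hW : IsCopyOf W (adjointRep n)) {x} (hx : x ∈ W.toSubmodule) :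
    TensorProduct.comm ℂ _ _ x = ((-1) ^ k : ℂ) • x := by
  obtain ⟨f, hf, hinj, hrange⟩ := hW.exists_equivariant
  rw [← hrange] at hx
  obtain ⟨A, rfl⟩ := hx
  by_cases hf0 : f = 0
  · subst hf0
    exact (LinearEquiv.map_zero _).trans (smul_zero _).symm
  · exact LinearMap.congr_fun (comm_comp_equivariant hf hk hf0) A

end Wedge

/-! ### Tensors indexed by cells, and the map to endomorphisms. -/

lemma sum_perm_eq_zero {T : Type*} [DecidableEq T] {M : Type*} [AddCommGroup M]
    [Module ℂ M] {S : Finset (Equiv.Perm T)}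
    {f : Equiv.Perm T → M} {c d : T} (hcd : c ≠ d) (hS : ∀ σ ∈ S, Equiv.swap c d * σ ∈ S)
    (hf : ∀ σ ∈ S, f σ + f (Equiv.swap c d * σ) = 0) : ∑ σ ∈ S, f σ = 0 := by
  refine Finset.sum_involution (fun σ _ => Equiv.swap c d * σ) hf ?_ hS ?_
  · intro σ _ _ h
    have := mul_right_cancel (h.trans (one_mul σ).symm)
    exact hcd (Equiv.swap_eq_one_iff.1 this)
  · intro σ _
    rw [← mul_assoc, Equiv.swap_mul_self, one_mul]

section Hook

variable {n : ℕ} {T : Type*} [Fintype T]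

/-- The coordinate of a tensor in `(ℂⁿ)^{⊗T}` with respect to the basis tensor
`⨂ₜ e_{s t}`. -/
noncomputable def tensorCoord (s : T → Fin n) : (⨂[ℂ] _ : T, (Fin n → ℂ)) →ₗ[ℂ] ℂ :=
  PiTensorProduct.lift
    ((MultilinearMap.mkPiAlgebra ℂ T ℂ).compLinearMap fun c => LinearMap.proj (s c))

@[simp] lemma tensorCoord_tprod (s : T → Fin n) (v : T → Fin n → ℂ) :
    tensorCoord s (PiTensorProduct.tprod ℂ v) = ∏ c, v c (s c) := by
  simp [tensorCoord]

lemma eq_zero_of_tensorCoord_eq_zero {x : ⨂[ℂ] _ : T, (Fin n → ℂ)}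
    (hx : ∀ s, tensorCoord s x = 0) : x = 0 := by
  refine (Basis.piTensorProduct fun _ : T => Pi.basisFun ℂ (Fin n)).ext_elem fun s => ?_
  have key : (Basis.piTensorProduct fun _ : T => Pi.basisFun ℂ (Fin n)).coord s
      = tensorCoord s := by
    refine PiTensorProduct.ext (MultilinearMap.ext fun v => ?_)
    simp [Basis.piTensorProduct_repr_tprod_apply]
  rw [← Basis.coord_apply, key, map_zero, Finsupp.zero_apply]
  exact hx s

lemma tensorCoord_reindex (s : T → Fin n) (σ : Equiv.Perm T) (x : ⨂[ℂ] _ : T, (Fin n → ℂ)) :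
    tensorCoord s (PiTensorProduct.reindex ℂ (fun _ : T => Fin n → ℂ) σ x)
      = tensorCoord (s ∘ σ) x := by
  suffices H : tensorCoord s ∘ₗ
      (PiTensorProduct.reindex ℂ (fun _ : T => Fin n → ℂ) σ).toLinearMap = tensorCoord (s ∘ σ) from
    LinearMap.congr_fun H x
  refine PiTensorProduct.ext (MultilinearMap.ext fun v => ?_)
  simp only [LinearMap.compMultilinearMap_apply, LinearMap.comp_apply, LinearEquiv.coe_coe]
  erw [PiTensorProduct.reindex_tprod]
  rw [tensorCoord_tprod, tensorCoord_tprod, ← Equiv.prod_comp σ]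
  simp

variable [DecidableEq T]

/-- The equivariant map `(ℂⁿ)^{⊗T} → End ℂⁿ`, for a set `T` with `n` elements and `a ∈ T`, sending
`⨂ₜ vₜ` to the endomorphism `u ↦ det(v with u in place of vₐ) vₐ`. -/
noncomputable def hookMap (e : T ≃ Fin n) (a : T) :
    (⨂[ℂ] _ : T, (Fin n → ℂ)) →ₗ[ℂ] Matrix (Fin n) (Fin n) ℂ where
  toFun x := Matrix.of fun i j => ∑ τ : Equiv.Perm T with e (τ a) = j,
    ((Equiv.Perm.sign τ : ℤ) : ℂ) * tensorCoord (Function.update (e ∘ τ) a i) x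
  map_add' x y := by
    ext i j
    simp [mul_add, Finset.sum_add_distrib]
  map_smul' c x := by
    ext i j
    simp [Finset.mul_sum, mul_left_comm]

lemma hookMap_apply (e : T ≃ Fin n) (a : T) (x : ⨂[ℂ] _ : T, (Fin n → ℂ)) (i j : Fin n) :
    hookMap e a x i j = ∑ τ : Equiv.Perm T with e (τ a) = j,
      ((Equiv.Perm.sign τ : ℤ) : ℂ) * tensorCoord (Function.update (e ∘ τ) a i) x := rfl

lemma det_of_comp_equiv (e : T ≃ Fin n) (v : T → Fin n → ℂ) :
    (Matrix.of fun c c' => v c (e c')).det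
      = ∑ τ : Equiv.Perm T, ((Equiv.Perm.sign τ : ℤ) : ℂ) * ∏ c, v c (e (τ c)) := by
  rw [← Matrix.det_transpose, Matrix.det_apply']
  rfl

lemma hookMap_tprod_mulVec (e : T ≃ Fin n) (a : T) (v : T → Fin n → ℂ) (u : Fin n → ℂ) :
    hookMap e a (PiTensorProduct.tprod ℂ v) *ᵥ u
      = (Matrix.of fun c c' => Function.update v a u c (e c')).det • v a := by
  ext i
  rw [Matrix.mulVec, dotProduct, det_of_comp_equiv, Pi.smul_apply, smul_eq_mul, Finset.sum_mul]
  simp only [hookMap_apply, Finset.sum_mul]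
  simp only [Finset.sum_filter]
  rw [Finset.sum_comm]
  refine Finset.sum_congr rfl fun τ _ => ?_
  rw [Finset.sum_ite_eq, if_pos (Finset.mem_univ _), tensorCoord_tprod,
    ← Finset.mul_prod_erase _ _ (Finset.mem_univ a),
    ← Finset.mul_prod_erase _ _ (Finset.mem_univ a)]
  have : ∏ c ∈ Finset.univ.erase a, v c (Function.update (e ∘ τ) a i c)
      = ∏ c ∈ Finset.univ.erase a, Function.update v a u c (e (τ c)) :=
    Finset.prod_congr rfl fun c hc => by simp [Finset.ne_of_mem_erase hc]
  rw [this, Function.update_self, Function.update_self]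
  ring

lemma hookMap_map (e : T ≃ Fin n) (a : T) (g : SL(n, ℂ)) (x : ⨂[ℂ] _ : T, (Fin n → ℂ)) :
    hookMap e a (tensorPow (stdRep n) T g x) * (g : Matrix (Fin n) (Fin n) ℂ)
      = g * hookMap e a x := by
  suffices H : (LinearMap.mulRight ℂ (g : Matrix (Fin n) (Fin n) ℂ)) ∘ₗ hookMap e a ∘ₗ
      tensorPow (stdRep n) T g = (LinearMap.mulLeft ℂ (g : Matrix (Fin n) (Fin n) ℂ)) ∘ₗ
      hookMap e a from LinearMap.congr_fun H x
  refine PiTensorProduct.ext (MultilinearMap.ext fun v => ?_)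
  simp only [LinearMap.compMultilinearMap_apply, LinearMap.comp_apply, LinearMap.mulRight_apply,
    LinearMap.mulLeft_apply]
  have h1 : tensorPow (stdRep n) T g (PiTensorProduct.tprod ℂ v)
      = PiTensorProduct.tprod ℂ fun c => (g : Matrix (Fin n) (Fin n) ℂ) *ᵥ v c :=
    PiTensorProduct.map_tprod _ _
  rw [h1]
  refine Matrix.ext_of_mulVec_single fun j => ?_
  rw [← Matrix.mulVec_mulVec, ← Matrix.mulVec_mulVec, hookMap_tprod_mulVec,
    hookMap_tprod_mulVec, Matrix.mulVec_smul]
  congr 1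
  set u : Fin n → ℂ := Pi.single j 1
  have h2 : (Matrix.of fun c c' => Function.update (fun c => (g : Matrix (Fin n) (Fin n) ℂ) *ᵥ v c)
      a ((g : Matrix (Fin n) (Fin n) ℂ) *ᵥ u) c (e c'))
      = (Matrix.of fun c c' => Function.update v a u c (e c'))
        * ((g : Matrix (Fin n) (Fin n) ℂ)ᵀ.submatrix e e) := by
    ext c c'
    have : Function.update (fun c => (g : Matrix (Fin n) (Fin n) ℂ) *ᵥ v c)
        a ((g : Matrix (Fin n) (Fin n) ℂ) *ᵥ u) c
        = (g : Matrix (Fin n) (Fin n) ℂ) *ᵥ Function.update v a u c := by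
      by_cases hc : c = a
      · subst hc; simp
      · simp [hc]
    rw [Matrix.of_apply, this, Matrix.mul_apply, Matrix.mulVec, dotProduct, ← Equiv.sum_comp e]
    simp [mul_comm]
  rw [h2, Matrix.det_mul, Matrix.det_submatrix_equiv_self, Matrix.det_transpose, g.2, mul_one]

lemma hookMap_reindex (e : T ≃ Fin n) {a : T} {σ : Equiv.Perm T} (hσ : σ a = a)
    (x : ⨂[ℂ] _ : T, (Fin n → ℂ)) :
    hookMap e a (PiTensorProduct.reindex ℂ (fun _ : T => Fin n → ℂ) σ x)
      = ((Equiv.Perm.sign σ : ℤ) : ℂ) • hookMap e a x := by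
  ext i j
  rw [Matrix.smul_apply, hookMap_apply, hookMap_apply, smul_eq_mul, Finset.mul_sum]
  refine Finset.sum_bij' (fun τ _ => τ * σ) (fun τ _ => τ * σ⁻¹) ?_ ?_ ?_ ?_ ?_
  · intro τ hτ
    simpa [hσ] using hτ
  · intro τ hτ
    have : σ⁻¹ a = a := by rw [Equiv.Perm.inv_eq_iff_eq, hσ]
    simp only [Finset.mem_filter, Finset.mem_univ, true_and, Equiv.Perm.mul_apply, this] at hτ ⊢
    exact hτ
  · intro τ _; simp
  · intro τ _; simp
  · intro τ _
    rw [tensorCoord_reindex]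
    have : Function.update (e ∘ τ) a i ∘ σ = Function.update (e ∘ (τ * σ)) a i := by
      funext c
      by_cases hc : c = a
      · subst hc; simp [hσ]
      · have : σ c ≠ a := fun h => hc (σ.injective (h.trans hσ.symm))
        simp [hc, this]
    rw [this, Equiv.Perm.sign_mul]
    rcases Int.units_eq_one_or (Equiv.Perm.sign σ) with h | h <;> simp [h]

/-- The trace contracts `u` with `vₐ` and so gives the determinant of all the `vₜ`, which is
alternating under every permutation and not only those fixing `a`. -/
lemma trace_hookMap (e : T ≃ Fin n) (a : T) (x : ⨂[ℂ] _ : T, (Fin n → ℂ)) :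
    (hookMap e a x).trace
      = ∑ τ : Equiv.Perm T, ((Equiv.Perm.sign τ : ℤ) : ℂ) * tensorCoord (e ∘ τ) x := by
  simp only [Matrix.trace, Matrix.diag_apply, hookMap_apply, Finset.sum_filter]
  rw [Finset.sum_comm]
  refine Finset.sum_congr rfl fun τ _ => ?_
  rw [Finset.sum_ite_eq, if_pos (Finset.mem_univ _)]
  congr 2
  exact congrArg _ (Function.update_eq_self a (e ∘ τ))

lemma trace_hookMap_reindex (e : T ≃ Fin n) (a : T) (σ : Equiv.Perm T)
    (x : ⨂[ℂ] _ : T, (Fin n → ℂ)) :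
    (hookMap e a (PiTensorProduct.reindex ℂ (fun _ : T => Fin n → ℂ) σ x)).trace
      = ((Equiv.Perm.sign σ : ℤ) : ℂ) * (hookMap e a x).trace := by
  rw [trace_hookMap, trace_hookMap, Finset.mul_sum, ← Equiv.sum_comp (Equiv.mulRight σ)
    (fun τ => ((Equiv.Perm.sign σ : ℤ) : ℂ) * (((Equiv.Perm.sign τ : ℤ) : ℂ) * _))]
  refine Finset.sum_congr rfl fun τ _ => ?_
  rw [tensorCoord_reindex, Equiv.coe_mulRight, Equiv.Perm.sign_mul]
  rcases Int.units_eq_one_or (Equiv.Perm.sign σ) with h | h <;> simp [h] <;> rfl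

/-- If `s` repeats a value away from `a`, the sum cancels in pairs. Otherwise `s` omits some `j`
there, and the sum is, up to sign, the `(s a, j)` entry of `hookMap`. -/
lemma tensorCoord_antisymmetrize (e : T ≃ Fin n) (a : T) {C : Finset (Equiv.Perm T)}
    (hC : ∀ σ, σ ∈ C ↔ σ a = a) {x : ⨂[ℂ] _ : T, (Fin n → ℂ)} (hx : hookMap e a x = 0)
    (s : T → Fin n) :
    ∑ σ ∈ C, ((Equiv.Perm.sign σ : ℤ) : ℂ) * tensorCoord (s ∘ σ) x = 0 := by
  by_cases hs : ∃ c d, c ≠ d ∧ c ≠ a ∧ d ≠ a ∧ s c = s d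
  · obtain ⟨c, d, hcd, hc, hd, hscd⟩ := hs
    refine sum_perm_eq_zero hcd (fun σ hσ => ?_) fun σ _ => ?_
    · rw [hC] at hσ ⊢
      rw [Equiv.Perm.mul_apply, hσ, Equiv.swap_apply_of_ne_of_ne hc.symm hd.symm]
    · have : s ∘ (Equiv.swap c d * σ) = s ∘ σ := by
        have h : s ∘ Equiv.swap c d = s := by
          funext t
          by_cases hct : t = c
          · subst hct; simp [hscd]
          by_cases hdt : t = d
          · subst hdt; simp [hscd]
          simp [Equiv.swap_apply_of_ne_of_ne hct hdt]
        rw [Equiv.Perm.coe_mul, ← Function.comp_assoc, h]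
      rw [this, Equiv.Perm.sign_mul, Equiv.Perm.sign_swap hcd]
      simp
  · push Not at hs
    obtain ⟨j, hj⟩ : ∃ j, ∀ c, c ≠ a → s c ≠ j := by
      by_contra! h
      choose r hr hr' using h
      have hinj : Function.Injective r := fun i j hij => by rw [← hr' i, ← hr' j, hij]
      have hsurj := ((Fintype.bijective_iff_injective_and_card r).2
        ⟨hinj, Fintype.card_congr e.symm⟩).2
      obtain ⟨i, hi⟩ := hsurj a
      exact hr i hi
    have hbij : Function.Bijective (Function.update s a j) := by
      refine (Fintype.bijective_iff_injective_and_card _).2 ⟨fun c d hcd => ?_,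
        Fintype.card_congr e⟩
      by_cases hc : c = a <;> by_cases hd : d = a
      · rw [hc, hd]
      · subst hc
        simp only [Function.update_self, Function.update_of_ne hd] at hcd
        exact absurd hcd.symm (hj d hd)
      · subst hd
        simp only [Function.update_self, Function.update_of_ne hc] at hcd
        exact absurd hcd (hj c hc)
      · simp only [Function.update_of_ne hd, Function.update_of_ne hc] at hcd
        by_contra hne
        exact hs c d hne hc hd hcd
    -- Replacing the value of `s` at `a` by the omitted `j` gives a bijection; left translation by
    -- `τ₀` matches the permutations fixing `a` with those indexing column `j` of `hookMap`.
    let τ₀ : Equiv.Perm T := (Equiv.ofBijective _ hbij).trans e.symm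
    have hτ₀ : ∀ c, e (τ₀ c) = Function.update s a j c := fun c => by simp [τ₀]
    have h := congrFun (congrFun hx (s a)) j
    rw [hookMap_apply, Matrix.zero_apply] at h
    have h2 : ((Equiv.Perm.sign τ₀ : ℤ) : ℂ) *
        ∑ σ ∈ C, ((Equiv.Perm.sign σ : ℤ) : ℂ) * tensorCoord (s ∘ σ) x = 0 := by
      rw [← h, Finset.mul_sum]
      refine Finset.sum_bij' (fun σ _ => τ₀ * σ) (fun τ _ => τ₀⁻¹ * τ) ?_ ?_ ?_ ?_ ?_
      · intro σ hσ
        rw [hC] at hσ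
        simp [hσ, hτ₀]
      · intro τ hτ
        rw [hC, Equiv.Perm.mul_apply, Equiv.Perm.inv_eq_iff_eq]
        refine e.injective ?_
        rw [hτ₀, Function.update_self]
        simpa using hτ
      · intro σ _; simp
      · intro τ _; simp
      · intro σ hσ
        rw [hC] at hσ
        have : Function.update (e ∘ (τ₀ * σ)) a (s a) = s ∘ σ := by
          funext c
          by_cases hc : c = a
          · subst hc; simp [hσ]
          · have : σ c ≠ a := fun h => hc (σ.injective (h.trans hσ.symm))
            simp [hc, this, hτ₀]
        rw [this, Equiv.Perm.sign_mul]
        push_cast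
        ring
    exact (mul_eq_zero.1 h2).resolve_left (by simp)

end Hook

/-! ### The hook `(2, 1ᵐ)` and its Schur module. -/

section HookDiagram

variable {n m : ℕ}

lemma mem_hookTwoOnes {c : ℕ × ℕ} :
    c ∈ (hookTwoOnes m).cells ↔ c.1 ≤ m ∧ c.2 = 0 ∨ c.1 = 0 ∧ c.2 = 1 := by
  obtain ⟨i, j⟩ := c
  rw [YoungDiagram.mem_cells, hookTwoOnes, YoungDiagram.mem_ofRowLens]
  cases i with
  | zero => simp; omega
  | succ i => simp

/-- The corner cell of the hook `(2, 1ᵐ)`. -/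
def hookCorner (m : ℕ) : (hookTwoOnes m).cells := ⟨(0, 0), mem_hookTwoOnes.2 (by simp)⟩

/-- The cell of the hook `(2, 1ᵐ)` in the second column. -/
def hookArm (m : ℕ) : (hookTwoOnes m).cells := ⟨(0, 1), mem_hookTwoOnes.2 (by simp)⟩

lemma hookCorner_ne_hookArm : hookCorner m ≠ hookArm m := by
  simp [hookCorner, hookArm]

lemma eq_hookArm_iff {c : (hookTwoOnes m).cells} : c = hookArm m ↔ c.1.2 = 1 := by
  refine ⟨fun h => h ▸ rfl, fun h => Subtype.ext (Prod.ext ?_ h)⟩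
  have := mem_hookTwoOnes.1 c.2
  simp only [hookArm]
  omega

lemma snd_eq_zero_of_ne_hookArm {c : (hookTwoOnes m).cells} (hc : c ≠ hookArm m) :
    c.1.2 = 0 := by
  have := mem_hookTwoOnes.1 c.2
  rw [Ne, eq_hookArm_iff] at hc
  omega

/-- A numbering of the cells of the hook `(2, 1ᵐ)`. -/
def hookEquiv (m : ℕ) : (hookTwoOnes m).cells ≃ Fin (m + 2) where
  toFun c := ⟨if c.1.2 = 1 then m + 1 else c.1.1, by
    have := mem_hookTwoOnes.1 c.2
    split_ifs <;> omega⟩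
  invFun i := if h : i.1 = m + 1 then hookArm m
    else ⟨(i.1, 0), mem_hookTwoOnes.2 (Or.inl ⟨by simp; omega, rfl⟩)⟩
  left_inv c := by
    by_cases hc : c = hookArm m
    · subst hc; simp [hookArm]
    · have h0 := snd_eq_zero_of_ne_hookArm hc
      have := mem_hookTwoOnes.1 c.2
      have h1 : c.1.1 ≠ m + 1 := by omega
      refine Subtype.ext (Prod.ext ?_ ?_) <;> simp [h0, h1]
  right_inv i := by
    by_cases h : i.1 = m + 1
    · simp [h, hookArm, Fin.ext_iff]
    · simp [h]

/-- The arm is the only cell of the second column, so preserving columns amounts to fixing it. This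
is what links the antisymmetrizer to `hookMap` at the arm. -/
lemma colAntisymmetrizer_hook (m : ℕ) : ∃ C : Finset (Equiv.Perm (hookTwoOnes m).cells),
    (∀ σ, σ ∈ C ↔ σ (hookArm m) = hookArm m) ∧ ∀ x : ⨂[ℂ] _ : (hookTwoOnes m).cells, (Fin n → ℂ),
      colAntisymmetrizer (Fin n → ℂ) (hookTwoOnes m) x
        = ∑ σ ∈ C, ((Equiv.Perm.sign σ : ℤ) : ℂ) •
          PiTensorProduct.reindex ℂ (fun _ : (hookTwoOnes m).cells => Fin n → ℂ) σ x := by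
  classical
  refine ⟨Finset.univ.filter fun σ => ∀ c : (hookTwoOnes m).cells, (σ c).1.2 = c.1.2,
    fun σ => ?_, fun x => ?_⟩
  · rw [Finset.mem_filter_univ]
    refine ⟨fun h => eq_hookArm_iff.2 (h _), fun h c => ?_⟩
    by_cases hc : c = hookArm m
    · rw [hc, h]
    · have : σ c ≠ hookArm m := fun h' => hc (σ.injective (h'.trans h.symm))
      rw [snd_eq_zero_of_ne_hookArm hc, snd_eq_zero_of_ne_hookArm this]
  · simp only [colAntisymmetrizer, LinearMap.sum_apply, LinearMap.smul_apply]
    refine Finset.sum_congr ?_ fun _ _ => rfl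
    ext σ
    simp

lemma rowSymmetrizer_hook (m : ℕ) : ∃ R : Finset (Equiv.Perm (hookTwoOnes m).cells),
    (∀ σ, σ ∈ R ↔ ∀ c, (σ c).1.1 = c.1.1) ∧ ∀ x : ⨂[ℂ] _ : (hookTwoOnes m).cells, (Fin n → ℂ),
      rowSymmetrizer (Fin n → ℂ) (hookTwoOnes m) x
        = ∑ σ ∈ R,
          PiTensorProduct.reindex ℂ (fun _ : (hookTwoOnes m).cells => Fin n → ℂ) σ x := by
  classical
  refine ⟨Finset.univ.filter fun σ => ∀ c : (hookTwoOnes m).cells, (σ c).1.1 = c.1.1,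
    fun σ => Finset.mem_filter_univ _, fun x => ?_⟩
  simp only [rowSymmetrizer, LinearMap.sum_apply]
  refine Finset.sum_congr ?_ fun _ _ => rfl
  ext σ
  simp

lemma colAntisymmetrizer_eq_zero (e : (hookTwoOnes m).cells ≃ Fin n)
    {x : ⨂[ℂ] _ : (hookTwoOnes m).cells, (Fin n → ℂ)} (hx : hookMap e (hookArm m) x = 0) :
    colAntisymmetrizer (Fin n → ℂ) (hookTwoOnes m) x = 0 := by
  obtain ⟨C, hC, hcol⟩ := colAntisymmetrizer_hook (n := n) m
  refine eq_zero_of_tensorCoord_eq_zero fun s => ?_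
  rw [hcol, map_sum, ← tensorCoord_antisymmetrize e (hookArm m) hC hx s]
  refine Finset.sum_congr rfl fun σ _ => ?_
  rw [map_smul, tensorCoord_reindex, smul_eq_mul]

lemma hookMap_colAntisymmetrizer (e : (hookTwoOnes m).cells ≃ Fin n) :
    ∃ N : ℂ, N ≠ 0 ∧ ∀ x, hookMap e (hookArm m)
      (colAntisymmetrizer (Fin n → ℂ) (hookTwoOnes m) x) = N • hookMap e (hookArm m) x := by
  obtain ⟨C, hC, hcol⟩ := colAntisymmetrizer_hook (n := n) m
  refine ⟨C.card, ?_, fun x => ?_⟩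
  · exact Nat.cast_ne_zero.2 (Finset.card_ne_zero.2 ⟨1, (hC 1).2 rfl⟩)
  · rw [hcol, map_sum, Nat.cast_smul_eq_nsmul, ← Finset.sum_const]
    refine Finset.sum_congr rfl fun σ hσ => ?_
    rw [map_smul, hookMap_reindex e ((hC σ).1 hσ), smul_smul]
    rcases Int.units_eq_one_or (Equiv.Perm.sign σ) with h | h <;> simp [h]

/-- The trace is alternating, whereas exchanging the two cells of the first row preserves the set of
row permutations; the terms cancel in pairs. -/
lemma trace_hookMap_rowSymmetrizer (e : (hookTwoOnes m).cells ≃ Fin n)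
    (x : ⨂[ℂ] _ : (hookTwoOnes m).cells, (Fin n → ℂ)) :
    (hookMap e (hookArm m) (rowSymmetrizer (Fin n → ℂ) (hookTwoOnes m) x)).trace = 0 := by
  obtain ⟨R, hR, hrow⟩ := rowSymmetrizer_hook (n := n) m
  rw [hrow, map_sum, Matrix.trace_sum]
  refine sum_perm_eq_zero (hookCorner_ne_hookArm (m := m)) (fun σ hσ => ?_) fun σ _ => ?_
  · rw [hR] at hσ ⊢
    intro c
    rw [← hσ c, Equiv.Perm.mul_apply, Equiv.swap_apply_def]
    split_ifs with h1 h2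
    · rw [h1]; rfl
    · rw [h2]; rfl
    · rfl
  · rw [trace_hookMap_reindex, trace_hookMap_reindex, Equiv.Perm.sign_mul,
      Equiv.Perm.sign_swap hookCorner_ne_hookArm]
    simp

lemma exists_hookMap_rowSymmetrizer (e : (hookTwoOnes m).cells ≃ Fin n) :
    ∃ (N : ℂ) (x : ⨂[ℂ] _ : (hookTwoOnes m).cells, (Fin n → ℂ)), N ≠ 0 ∧
      hookMap e (hookArm m) (rowSymmetrizer (Fin n → ℂ) (hookTwoOnes m) x)
        = N • Matrix.single (e (hookCorner m)) (e (hookArm m)) 1 := by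
  obtain ⟨R, hR, hrow⟩ := rowSymmetrizer_hook (n := n) m
  -- The test tensor carries the same basis vector at the corner and at the arm and distinct ones
  -- elsewhere. It is constant along rows, so row permutations fix it.
  let ψ : (hookTwoOnes m).cells → (hookTwoOnes m).cells :=
    fun c => if c = hookArm m then hookCorner m else c
  have hψ : ∀ c, (ψ c).1 = (c.1.1, 0) := by
    intro c
    by_cases hc : c = hookArm m
    · subst hc; simp [ψ, hookArm, hookCorner]
    · simp only [ψ, if_neg hc]
      exact Prod.ext rfl (snd_eq_zero_of_ne_hookArm hc)
  let v : (hookTwoOnes m).cells → Fin n → ℂ := fun c => Pi.single (e (ψ c)) 1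
  refine ⟨R.card, PiTensorProduct.tprod ℂ v,
    Nat.cast_ne_zero.2 (Finset.card_ne_zero.2 ⟨1, (hR 1).2 fun _ => rfl⟩), ?_⟩
  have h1 : ∀ σ ∈ R, PiTensorProduct.reindex ℂ (fun _ : (hookTwoOnes m).cells => Fin n → ℂ) σ
      (PiTensorProduct.tprod ℂ v) = PiTensorProduct.tprod ℂ v := by
    intro σ hσ
    rw [hR] at hσ
    refine (PiTensorProduct.reindex_tprod σ v).trans (congrArg _ (funext fun c => ?_))
    have : ψ (σ.symm c) = ψ c := by
      refine Subtype.ext ?_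
      rw [hψ, hψ, ← hσ (σ.symm c), Equiv.apply_symm_apply]
    simp only [v, this]
  rw [hrow, Finset.sum_congr rfl h1, Finset.sum_const, map_nsmul, Nat.cast_smul_eq_nsmul]
  congr 1
  refine Matrix.ext_of_mulVec_single fun j => ?_
  rw [hookMap_tprod_mulVec]
  have hv : v (hookArm m) = Pi.single (e (hookCorner m)) 1 := by simp [v, ψ]
  -- Putting `u` at the arm gives the identity matrix with one row replaced, so the determinant is
  -- the coordinate of `u` at the arm's index.
  have hdet : (Matrix.of fun c c' => Function.update v (hookArm m) (Pi.single j 1) c (e c')).det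
      = (Pi.single j 1 : Fin n → ℂ) (e (hookArm m)) := by
    have : (Matrix.of fun c c' => Function.update v (hookArm m) (Pi.single j 1) c (e c'))
        = (1 : Matrix _ _ ℂ).updateRow (hookArm m) fun c' => (Pi.single j 1 : Fin n → ℂ) (e c') := by
      ext c c'
      by_cases hc : c = hookArm m
      · subst hc; simp
      · simp [hc, v, ψ, Matrix.one_apply, Pi.single_apply, eq_comm]
    rw [this, ← Matrix.transpose_one, Matrix.updateRow_transpose, Matrix.det_transpose,
      ← Matrix.cramer_apply]
    simp
  rw [hdet, hv]
  ext i
  simp only [Pi.smul_apply, smul_eq_mul, Pi.single_apply, Matrix.mulVec_single_one,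
    Matrix.col_apply, Matrix.single_apply]
  grind

lemma hookMap_mem_sl (e : (hookTwoOnes m).cells ≃ Fin n)
    (x : (schurSubrep (stdRep n) (hookTwoOnes m)).toSubmodule) :
    hookMap e (hookArm m) x.1 ∈ LieAlgebra.SpecialLinear.sl (Fin n) ℂ := by
  obtain ⟨_, y, rfl⟩ := x
  obtain ⟨N, -, hcol⟩ := hookMap_colAntisymmetrizer e
  change (hookMap e (hookArm m) (youngSymmetrizer _ (hookTwoOnes m) y)).trace = 0
  rw [youngSymmetrizer, LinearMap.comp_apply, hcol, Matrix.trace_smul,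
    trace_hookMap_rowSymmetrizer, smul_zero]

/-- The restriction of `hookMap` to the Schur module of the hook, as a map to `𝔰𝔩ₙ`. -/
noncomputable def schurToSl (e : (hookTwoOnes m).cells ≃ Fin n) :
    (schurSubrep (stdRep n) (hookTwoOnes m)).toSubmodule →ₗ[ℂ]
      LieAlgebra.SpecialLinear.sl (Fin n) ℂ where
  toFun x := ⟨hookMap e (hookArm m) x.1, hookMap_mem_sl e x⟩
  map_add' x y := Subtype.ext (map_add (hookMap e (hookArm m)) x.1 y.1)
  map_smul' c x := Subtype.ext (map_smul (hookMap e (hookArm m)) c x.1)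

lemma schurToSl_schurModule (e : (hookTwoOnes m).cells ≃ Fin n) (g : SL(n, ℂ))
    (x : (schurSubrep (stdRep n) (hookTwoOnes m)).toSubmodule) :
    schurToSl e (schurModule (stdRep n) (hookTwoOnes m) g x)
      = adjointRep n g (schurToSl e x) := by
  symm
  apply adjointRep_eq
  have hx : (schurToSl e x).1 = hookMap e (hookArm m) x.1 := rfl
  have hgx : (schurToSl e (schurModule (stdRep n) (hookTwoOnes m) g x)).1
      = hookMap e (hookArm m) (tensorPow (stdRep n) (hookTwoOnes m).cells g x.1) := by
    have h : (schurModule (stdRep n) (hookTwoOnes m) g x).1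
        = tensorPow (stdRep n) (hookTwoOnes m).cells g x.1 := rfl
    rw [← h]
    rfl
  rw [hx, hgx, hookMap_map]

lemma schurToSl_injective (e : (hookTwoOnes m).cells ≃ Fin n) :
    Function.Injective (schurToSl e) := by
  obtain ⟨N, hN, hcol⟩ := hookMap_colAntisymmetrizer e
  refine (injective_iff_map_eq_zero _).2 ?_
  rintro ⟨_, y, rfl⟩ hx
  have hx' : hookMap e (hookArm m) (youngSymmetrizer _ (hookTwoOnes m) y) = 0 :=
    congrArg Subtype.val hx
  rw [youngSymmetrizer, LinearMap.comp_apply, hcol] at hx'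
  -- Dividing by `N` shows that `hookMap` already kills the row-symmetrized tensor, hence so does
  -- the column antisymmetrizer.
  exact Subtype.ext (colAntisymmetrizer_eq_zero e ((smul_eq_zero.1 hx').resolve_left hN))

lemma schurToSl_surjective (e : (hookTwoOnes m).cells ≃ Fin n) :
    Function.Surjective (schurToSl e) := by
  obtain ⟨N, hN, hcol⟩ := hookMap_colAntisymmetrizer e
  have hne : e (hookCorner m) ≠ e (hookArm m) := e.injective.ne hookCorner_ne_hookArm
  rw [← LinearMap.range_eq_top]
  refine eq_top_of_single_mem ?_ hne ?_
  · rintro g _ ⟨x, rfl⟩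
    exact ⟨_, schurToSl_schurModule e g x⟩
  · obtain ⟨N', y, hN', hy⟩ := exists_hookMap_rowSymmetrizer e
    refine (Submodule.smul_mem_iff _ (mul_ne_zero hN hN')).1
      ⟨⟨youngSymmetrizer _ (hookTwoOnes m) y, y, rfl⟩, Subtype.ext ?_⟩
    change hookMap e (hookArm m) (youngSymmetrizer _ (hookTwoOnes m) y) = _
    rw [youngSymmetrizer, LinearMap.comp_apply, hcol, hy, smul_smul]
    rfl

/-- The Schur module `S_{2,1ⁿ⁻²} ℂⁿ` is isomorphic to the adjoint representation. -/
lemma nonempty_adjointRep_equiv_schurModule (hn : 2 ≤ n) :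
    Nonempty ((adjointRep n).Equiv (schurModule (stdRep n) (hookTwoOnes (n - 2)))) := by
  have e : (hookTwoOnes (n - 2)).cells ≃ Fin n :=
    (hookEquiv (n - 2)).trans (finCongr (by omega))
  exact ⟨(Representation.Equiv.mk (ρ := schurModule (stdRep n) (hookTwoOnes (n - 2)))
    (σ := adjointRep n)
    (LinearEquiv.ofBijective (schurToSl e) ⟨schurToSl_injective e, schurToSl_surjective e⟩)
    fun g => LinearMap.ext fun x => schurToSl_schurModule e g x).symm⟩

end HookDiagram

end DualBrackets

theorem mainTheorem4 (n k : ℕ) (hk : 0 < k) (hkn : k < n) :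
    -- `Λ^{n-k} ℂⁿ` is the dual of `Λᵏ ℂⁿ`, and `𝔰𝔩ₙ = S_{2,1^{n-2}} ℂⁿ`
    Nonempty ((DualBrackets.wedge n (n - k)).Equiv (DualBrackets.wedge n k).dual) ∧
    Nonempty ((DualBrackets.adjointRep n).Equiv
      (DualBrackets.schurModule (DualBrackets.stdRep n) (DualBrackets.hookTwoOnes (n - 2)))) ∧
    -- there is exactly one copy of `𝔰𝔩ₙ` in `Λᵏ ℂⁿ ⊗ Λ^{n-k} ℂⁿ`
    (∃! W : Subrepresentation
        ((DualBrackets.wedge n k).tprod (DualBrackets.wedge n (n - k))),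
      DualBrackets.IsCopyOf W (DualBrackets.adjointRep n)) ∧
    -- if `n = 2k`, the unique copy in `M ⊗ M` lies in `S² M` or `Λ² M` by the parity of `k`
    (n = 2 * k →
      ∃ W : Subrepresentation ((DualBrackets.wedge n k).tprod (DualBrackets.wedge n k)),
        DualBrackets.IsCopyOf W (DualBrackets.adjointRep n) ∧
        (∀ W' : Subrepresentation ((DualBrackets.wedge n k).tprod (DualBrackets.wedge n k)),
          DualBrackets.IsCopyOf W' (DualBrackets.adjointRep n) → W' = W) ∧
        (Odd k → W.toSubmodule ≤ DualBrackets.symTensors (⋀[ℂ]^k (Fin n → ℂ))) ∧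
        (Even k → W.toSubmodule ≤ DualBrackets.skewTensors (⋀[ℂ]^k (Fin n → ℂ)))) := by
  have hkn' : n - k + k = n := Nat.sub_add_cancel hkn.le
  refine ⟨DualBrackets.nonempty_wedge_equiv_dual hkn',
    DualBrackets.nonempty_adjointRep_equiv_schurModule (by omega),
    DualBrackets.existsUnique_isCopyOf_adjointRep hk (Nat.sub_pos_of_lt hkn) (by omega),
    fun hn => ?_⟩
  obtain ⟨W, hW, huniq⟩ := DualBrackets.existsUnique_isCopyOf_adjointRep hk hk
    (show k + k = n by omega)
  -- The swap acts by `(-1)^j` with `k = j + 1`, so the parity is opposite to that of `k`.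
  obtain ⟨j, rfl⟩ := Nat.exists_eq_succ_of_ne_zero hk.ne'
  have hcomm := fun x hx => DualBrackets.comm_eq_of_mem_isCopyOf
    (show j + 1 + (j + 1) = n by omega) hW (x := x) hx
  refine ⟨W, hW, huniq, fun hodd x hx => ?_, fun heven x hx => ?_⟩
  · have hj : Even j := by
      rcases Nat.even_or_odd j with h | h
      · exact h
      · exact absurd hodd (Nat.not_odd_iff_even.2 h.add_one)
    have h := hcomm x hx
    rw [hj.neg_one_pow, one_smul] at h
    exact h
  · have hj : Odd j := by
      rcases Nat.even_or_odd j with h | h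
      · exact absurd heven (Nat.not_even_iff_odd.2 h.add_one)
      · exact h
    have h := hcomm x hx
    rw [hj.neg_one_pow] at h
    exact h.trans (neg_one_smul ℂ x)
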